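/- All graphs are finite and simple. The odd-girth of a graph is the length of its shortest odd cycle. For $d \ge 1$, $PC(d)$ is the Cayley graph on $\mathbb{Z}_2^{d}$ with connection set $\{e_1,\dots,e_d,J\}$, where $e_1,\dots,e_d$ is the standard basis and $J$ is the all-ones vector. Let $k \ge 1$. Call a graph $B$ a $k$-bound if $B$ has odd-girth $2k+1$ and every planar graph of odd-girth $2k+1$ admits a homomorphism to $B$. (1) Every $k$-bound $B$ satisfies $|V(B)| \ge 2^{2k}$. (2) If $B$ is a minimal $k$-bound, meaning that no proper induced subgraph of $B$ is a $k$-bound (in particular, if no proper subgraph of $B$ is a $k$-bound), then the minimum degree satisfies $\delta(B) \ge 2k+1$. (3) Suppose that every planar graph of odd-girth at least $2k+1$ admits a homomorphism to $PC(2k)$. Then $PC(2k)$ is a $k$-bound, and every $k$-bound $B$ satisfies $|V(B)| \ge |V(PC(2k))|$ and $|E(B)| \ge |E(PC(2k))|$. -/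

import Mathlib

universe u

/-- The odd-girth of a graph: the length of a shortest odd cycle (`⊤` if there is none). -/
noncomputable def SimpleGraph.oddGirth {V : Type*} (G : SimpleGraph V) : ℕ∞ :=
  ⨅ (a : V) (w : G.Walk a a) (_ : w.IsCycle ∧ Odd w.length), (w.length : ℕ∞)

/-- `A` is a polygonal arc in the plane with ends `x` and `y`: the image of an injective path
from `x` to `y` that is a union of finitely many straight line segments. -/
def IsPolygonalArc (A : Set (ℝ × ℝ)) (x y : ℝ × ℝ) : Prop :=
  (∃ γ : Path x y, Function.Injective γ ∧ Set.range γ = A) ∧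
    ∃ F : Finset ((ℝ × ℝ) × (ℝ × ℝ)), A = ⋃ s ∈ F, segment ℝ s.1 s.2

/-- A drawing of a graph in the plane without crossings: the vertices are distinct points, an edge
`uv` is a polygonal arc between the points of `u` and `v`, the only vertices on an edge are its two
ends, and two different edges meet at most in common ends. -/
structure SimpleGraph.PlaneDrawing {V : Type*} (G : SimpleGraph V) where
  /-- The point of a vertex. -/
  point : V → ℝ × ℝ
  /-- The arc of an edge (only the values on the edges of `G` matter). -/
  arc : Sym2 V → Set (ℝ × ℝ)
  point_injective : Function.Injective point
  arc_polygonal : ∀ u v : V, G.Adj u v → IsPolygonalArc (arc s(u, v)) (point u) (point v)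
  mem_of_point_mem_arc : ∀ e ∈ G.edgeSet, ∀ w : V, point w ∈ arc e → w ∈ e
  arc_inter_arc : ∀ e ∈ G.edgeSet, ∀ f ∈ G.edgeSet, e ≠ f →
    ∀ p ∈ arc e ∩ arc f, ∃ w : V, w ∈ e ∧ w ∈ f ∧ point w = p

/-- A graph is planar if it can be drawn in the plane without crossings. -/
def SimpleGraph.IsPlanar {V : Type*} (G : SimpleGraph V) : Prop :=
  Nonempty G.PlaneDrawing

/-- `B` is a graph of odd-girth `2k+1` to which every (finite) planar graph of odd-girth `2k+1`
admits a homomorphism. -/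
def IsPlanarBound (k : ℕ) {V : Type*} (B : SimpleGraph V) : Prop :=
  B.oddGirth = ((2 * k + 1 : ℕ) : ℕ∞) ∧
    ∀ (W : Type) [Finite W] (G : SimpleGraph W),
      G.IsPlanar → G.oddGirth = ((2 * k + 1 : ℕ) : ℕ∞) → Nonempty (G →g B)

/-- `B` is minimal with the property `IsPlanarBound k`: no proper induced subgraph of `B` has it.
This is the weakest form of minimality: it holds if no proper subgraph of `B` has the property, and
it holds if no graph with fewer vertices has it. -/
def IsMinimalPlanarBound (k : ℕ) {V : Type*} (B : SimpleGraph V) : Prop :=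
  IsPlanarBound k B ∧ ∀ S : Set V, S ≠ Set.univ → ¬ IsPlanarBound k (B.induce S)

/-- The projective cube of dimension `d`: the Cayley graph of `(ℤ/2)^d` with respect to the
standard basis vectors and the all-ones vector. -/
def projectiveCube (d : ℕ) : SimpleGraph (Fin d → ZMod 2) :=
  SimpleGraph.addCayley (insert (fun _ => 1) (Set.range fun i : Fin d => Pi.single i 1))

/-- The conjecture for `d = 2k`: every (finite) planar graph of odd-girth at least `2k+1` admits a
homomorphism to the projective cube of dimension `2k`. -/
def PlanarProjectiveCubeConjecture (k : ℕ) : Prop :=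
  ∀ (W : Type) [Finite W] (G : SimpleGraph W),
    G.IsPlanar → ((2 * k + 1 : ℕ) : ℕ∞) ≤ G.oddGirth → Nonempty (G →g projectiveCube (2 * k))

/-! If two vertices are joined by a walk of odd length below `2 * k`, no homomorphism to a graph of
odd-girth at least `2 * k + 1` identifies them. So (1) follows from a planar graph of odd-girth `2 *
k + 1` with `2 ^ (2 * k)` vertices pairwise joined by such walks (`exists_planar_clique`).

That graph is built by doubling. A gadget of rank `r` has poles `s`, `t` and `2 ^ r` selected
vertices, each on an `s`-`t` walk of length `r`. Rank `r + 1` comes from a path `s a … b t`, with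
`a` and `b` joined by a path of length `2 * k - r`, and rank `r` gadgets between `s`, `b` and
between `a`, `t` (`nonempty_gadget_succ`). At rank `2 * k` an edge joins the poles. Labelling all
vertices by `projectiveCube (2 * k)`, homomorphically, keeps the odd-girth at least `2 * k + 1`;
explicit nested triangles keep the drawing plane.

The pole `s` also has `2 * k + 1` neighbours that are pairwise inseparable in this way, so its image
has degree at least `2 * k + 1`. For (2), if `B - v` is not a bound, some planar `G` does not map to
it. Glue a gadget by its pole `s` to every vertex of `G` and map the result to `B`: some vertex of
`G` goes to `v`, which therefore has large degree. For the edge count in (3), sum degrees over a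
minimal induced bound. -/

/-! ### Labelled plane drawings and their unions -/

/-- A plane drawing, inside the region `K`, of the graph `G` whose vertices are the points of the
finite set `V`, together with the property that `φ` maps `G` homomorphically to `Q`. -/
structure IsDrawnIn {T : Type*} (Q : SimpleGraph T) (K V : Set (ℝ × ℝ)) (G : SimpleGraph (ℝ × ℝ))
    (φ : ℝ × ℝ → T) (arc : Sym2 (ℝ × ℝ) → Set (ℝ × ℝ)) : Prop where
  finite : V.Finite
  subset : V ⊆ K
  adj_mem : ∀ u v, G.Adj u v → u ∈ V
  polygonal : ∀ u v, G.Adj u v → IsPolygonalArc (arc s(u, v)) u v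
  arc_subset : ∀ e ∈ G.edgeSet, arc e ⊆ K
  mem_of_mem_arc : ∀ e ∈ G.edgeSet, ∀ w ∈ V, w ∈ arc e → w ∈ e
  arc_inter : ∀ e ∈ G.edgeSet, ∀ f ∈ G.edgeSet, e ≠ f → ∀ p ∈ arc e ∩ arc f, p ∈ e ∧ p ∈ f
  hom : ∀ u v, G.Adj u v → Q.Adj (φ u) (φ v)

namespace IsDrawnIn

variable {T : Type*} {Q : SimpleGraph T} {K K' V V' : Set (ℝ × ℝ)} {G G' : SimpleGraph (ℝ × ℝ)}
  {φ φ' : ℝ × ℝ → T} {arc arc' : Sym2 (ℝ × ℝ) → Set (ℝ × ℝ)}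

theorem mono (h : IsDrawnIn Q K V G φ arc) (hK : K ⊆ K') : IsDrawnIn Q K' V G φ arc :=
  { h with
    subset := h.subset.trans hK
    arc_subset := fun e he => (h.arc_subset e he).trans hK }

/-- Two drawings whose regions meet only in common vertices can be put together. -/
theorem union (h : IsDrawnIn Q K V G φ arc) (h' : IsDrawnIn Q K' V' G' φ' arc')
    (hKK : ∀ p ∈ K, p ∈ K' → p ∈ V ∧ p ∈ V' ∧ φ p = φ' p) :
    ∃ φ₁ arc₁, (∀ p ∈ V, φ₁ p = φ p) ∧ (∀ p ∈ V', φ₁ p = φ' p) ∧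
      IsDrawnIn Q (K ∪ K') (V ∪ V') (G ⊔ G') φ₁ arc₁ := by
  classical
  have hK : K ∩ K' ⊆ V ∩ V' := fun p hp => ⟨(hKK p hp.1 hp.2).1, (hKK p hp.1 hp.2).2.1⟩
  have hV : ∀ p ∈ V, (if p ∈ V then φ p else φ' p) = φ p := fun p hp => if_pos hp
  have hV' : ∀ p ∈ V', (if p ∈ V then φ p else φ' p) = φ' p := fun p hp => by
    split_ifs with hpV
    · exact (hKK p (h.subset hpV) (h'.subset hp)).2.2
    · rfl
  have key : ∀ e ∈ (G ⊔ G').edgeSet,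
      (e ∈ G.edgeSet ∧ (if e ∈ G.edgeSet then arc e else arc' e) = arc e) ∨
      (e ∈ G'.edgeSet ∧ (if e ∈ G.edgeSet then arc e else arc' e) = arc' e) := by
    intro e he
    by_cases heG : e ∈ G.edgeSet
    · exact .inl ⟨heG, if_pos heG⟩
    · rw [SimpleGraph.edgeSet_sup] at he
      exact .inr ⟨he.resolve_left heG, if_neg heG⟩
  -- Arcs of different drawings meet only where the regions do, so in a common vertex, which must be
  -- an end of both edges.
  have cross : ∀ e ∈ G.edgeSet, ∀ f ∈ G'.edgeSet, ∀ p, p ∈ arc e → p ∈ arc' f → p ∈ e ∧ p ∈ f := by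
    intro e he f hf p hp hp'
    obtain ⟨h1, h2⟩ := hK ⟨h.arc_subset e he hp, h'.arc_subset f hf hp'⟩
    exact ⟨h.mem_of_mem_arc e he p h1 hp, h'.mem_of_mem_arc f hf p h2 hp'⟩
  refine ⟨fun p => if p ∈ V then φ p else φ' p,
    fun e => if e ∈ G.edgeSet then arc e else arc' e, hV, hV', ?_⟩
  constructor
  · exact h.finite.union h'.finite
  · exact Set.union_subset_union h.subset h'.subset
  · rintro u v (huv | huv)
    · exact .inl (h.adj_mem _ _ huv)
    · exact .inr (h'.adj_mem _ _ huv)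
  · intro u v huv
    rcases key s(u, v) huv with ⟨h1, h2⟩ | ⟨h1, h2⟩
    · simp only [h2]
      exact h.polygonal u v h1
    · simp only [h2]
      exact h'.polygonal u v h1
  · intro e he
    rcases key e he with ⟨h1, h2⟩ | ⟨h1, h2⟩
    · simp only [h2]
      exact (h.arc_subset e h1).trans Set.subset_union_left
    · simp only [h2]
      exact (h'.arc_subset e h1).trans Set.subset_union_right
  · intro e he w hw hwe
    rcases key e he with ⟨h1, h2⟩ | ⟨h1, h2⟩ <;> simp only [h2] at hwe
    · rcases hw with hw | hw
      · exact h.mem_of_mem_arc e h1 w hw hwe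
      · exact h.mem_of_mem_arc e h1 w (hK ⟨h.arc_subset e h1 hwe, h'.subset hw⟩).1 hwe
    · rcases hw with hw | hw
      · exact h'.mem_of_mem_arc e h1 w (hK ⟨h.subset hw, h'.arc_subset e h1 hwe⟩).2 hwe
      · exact h'.mem_of_mem_arc e h1 w hw hwe
  · rintro e he f hf hef p ⟨hp, hp'⟩
    rcases key e he with ⟨h1, h2⟩ | ⟨h1, h2⟩ <;> simp only [h2] at hp <;>
      rcases key f hf with ⟨h3, h4⟩ | ⟨h3, h4⟩ <;> simp only [h4] at hp'
    · exact h.arc_inter e h1 f h3 hef p ⟨hp, hp'⟩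
    · exact cross e h1 f h3 p hp hp'
    · exact (cross f h3 e h1 p hp' hp).symm
    · exact h'.arc_inter e h1 f h3 hef p ⟨hp, hp'⟩
  · rintro u v (huv | huv)
    · simp only [hV u (h.adj_mem _ _ huv), hV v (h.adj_mem _ _ huv.symm)]
      exact h.hom u v huv
    · simp only [hV' u (h'.adj_mem _ _ huv), hV' v (h'.adj_mem _ _ huv.symm)]
      exact h'.hom u v huv

/-- `G` has every point of the plane as a vertex, but no edges outside `V`; inducing on `V` discards
isolated points only and leaves a finite graph. -/
theorem isPlanar_induce (h : IsDrawnIn Q K V G φ arc) : (G.induce V).IsPlanar := by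
  have hmem : ∀ e : Sym2 V, e ∈ (G.induce V).edgeSet → e.map Subtype.val ∈ G.edgeSet := by
    intro e
    induction e with
    | _ x y => exact fun h => h
  refine ⟨⟨Subtype.val, fun e => arc (e.map Subtype.val), Subtype.val_injective, ?_, ?_, ?_⟩⟩
  · exact fun u v huv => h.polygonal u v huv
  · intro e he w hw
    obtain ⟨a, ha, haw⟩ := Sym2.mem_map.1 (h.mem_of_mem_arc _ (hmem e he) w w.2 hw)
    exact Subtype.val_injective haw ▸ ha
  · intro e he f hf hef p hp
    obtain ⟨h1, h2⟩ := h.arc_inter _ (hmem e he) _ (hmem f hf)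
      (fun hh => hef (Sym2.map.injective Subtype.val_injective hh)) p hp
    obtain ⟨a, ha, rfl⟩ := Sym2.mem_map.1 h1
    obtain ⟨b, hb, hab⟩ := Sym2.mem_map.1 h2
    exact ⟨a, ha, Subtype.val_injective hab ▸ hb, rfl⟩

end IsDrawnIn

theorem isPolygonalArc_segment {p q : ℝ × ℝ} (h : p ≠ q) :
    IsPolygonalArc (segment ℝ p q) p q :=
  ⟨⟨Path.segment p q, Path.segment_injective_of_ne h, Path.range_segment p q⟩, {(p, q)}, by simp⟩

/-- A single straight edge. -/
theorem isDrawnIn_edge {T : Type*} (Q : SimpleGraph T) {p q : ℝ × ℝ} (h : p ≠ q) {φ : ℝ × ℝ → T}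
    (hφ : Q.Adj (φ p) (φ q)) :
    IsDrawnIn Q (segment ℝ p q) {p, q} (SimpleGraph.edge p q) φ (fun _ => segment ℝ p q) := by
  have hE : ∀ e ∈ (SimpleGraph.edge p q).edgeSet, e = s(p, q) := fun e he => by
    simpa using SimpleGraph.edgeSet_edge_subset he
  have hadj : ∀ u v, (SimpleGraph.edge p q).Adj u v → (u = p ∧ v = q) ∨ (u = q ∧ v = p) :=
    fun u v huv => ((SimpleGraph.edge_adj ..).1 huv).1
  constructor
  · simp
  · rintro x (rfl | rfl)
    · exact left_mem_segment ..
    · exact right_mem_segment ..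
  · intro u v huv
    rcases hadj u v huv with ⟨rfl, rfl⟩ | ⟨rfl, rfl⟩ <;> simp
  · intro u v huv
    rcases hadj u v huv with ⟨rfl, rfl⟩ | ⟨rfl, rfl⟩
    · exact isPolygonalArc_segment h
    · rw [segment_symm]
      exact isPolygonalArc_segment h.symm
  · exact fun _ _ => subset_rfl
  · intro e he w hw _
    rw [hE e he]
    simpa using hw
  · intro e he f hf hef
    exact absurd ((hE e he).trans (hE f hf).symm) hef
  · intro u v huv
    rcases hadj u v huv with ⟨rfl, rfl⟩ | ⟨rfl, rfl⟩
    · exact hφ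
    · exact hφ.symm

/-- The drawing of a planar graph, with the vertices identified with their points. -/
theorem SimpleGraph.PlaneDrawing.isDrawnIn {W : Type*} [Finite W] {G : SimpleGraph W}
    (D : G.PlaneDrawing) :
    ∃ K arc, IsDrawnIn (⊤ : SimpleGraph (ℝ × ℝ)) K (Set.range D.point)
      (G.map D.point) id arc := by
  have hE : ∀ e ∈ (G.map D.point).edgeSet, ∃ e' ∈ G.edgeSet, e'.map D.point = e := by
    intro e
    induction e with
    | _ x y =>
      rintro ⟨_, a, b, hab, rfl, rfl⟩
      exact ⟨s(a, b), hab, rfl⟩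
  have harc := (Sym2.map.injective D.point_injective).extend_apply D.arc (fun _ => ∅)
  refine ⟨Set.univ, Function.extend (Sym2.map D.point) D.arc (fun _ => ∅), ?_⟩
  constructor
  · exact Set.finite_range _
  · exact Set.subset_univ _
  · rintro _ _ ⟨_, a, b, hab, rfl, rfl⟩
    exact ⟨a, rfl⟩
  · rintro _ _ ⟨_, a, b, hab, rfl, rfl⟩
    rw [← Sym2.map_mk, harc]
    exact D.arc_polygonal a b hab
  · exact fun _ _ => Set.subset_univ _
  · rintro e he _ ⟨w, rfl⟩ hw
    obtain ⟨e', he', rfl⟩ := hE e he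
    rw [harc] at hw
    exact Sym2.mem_map.2 ⟨w, D.mem_of_point_mem_arc e' he' w hw, rfl⟩
  · rintro e he f hf hef p hp
    obtain ⟨e', he', rfl⟩ := hE e he
    obtain ⟨f', hf', rfl⟩ := hE f hf
    rw [harc, harc] at hp
    obtain ⟨w, h1, h2, rfl⟩ := D.arc_inter_arc e' he' f' hf' (fun hh => hef (hh ▸ rfl)) p hp
    exact ⟨Sym2.mem_map.2 ⟨w, h1, rfl⟩, Sym2.mem_map.2 ⟨w, h2, rfl⟩⟩
  · exact fun u v huv => huv.ne

/-- The region of a drawing can be taken to be a finite union of segments. -/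
theorem IsDrawnIn.exists_segments {T : Type*} {Q : SimpleGraph T} {K V : Set (ℝ × ℝ)}
    {G : SimpleGraph (ℝ × ℝ)} {φ : ℝ × ℝ → T} {arc : Sym2 (ℝ × ℝ) → Set (ℝ × ℝ)}
    (h : IsDrawnIn Q K V G φ arc) :
    ∃ F : Set ((ℝ × ℝ) × (ℝ × ℝ)), F.Finite ∧
      IsDrawnIn Q (⋃ s ∈ F, segment ℝ s.1 s.2) V G φ arc := by
  have hE : G.edgeSet.Finite := by
    refine ((h.finite.prod h.finite).image fun p => s(p.1, p.2)).subset fun e he => ?_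
    induction e with
    | _ x y =>
      exact ⟨(x, y), ⟨h.adj_mem _ _ he, h.adj_mem _ _ (SimpleGraph.Adj.symm (G := G) he)⟩, rfl⟩
  have hF : ∀ e ∈ G.edgeSet, ∃ F : Finset ((ℝ × ℝ) × (ℝ × ℝ)),
      arc e = ⋃ s ∈ F, segment ℝ s.1 s.2 := by
    intro e
    induction e with
    | _ x y => exact fun he => (h.polygonal x y he).2
  choose! F hF using hF
  -- The degenerate segments keep isolated vertices inside the region.
  refine ⟨(fun p => (p, p)) '' V ∪ ⋃ e ∈ G.edgeSet, (F e : Set ((ℝ × ℝ) × (ℝ × ℝ))),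
    (h.finite.image _).union (hE.biUnion fun e _ => (F e).finite_toSet), { h with
      subset := fun p hp => ?_, arc_subset := fun e he => ?_ }⟩
  · exact Set.mem_biUnion (.inl ⟨p, hp, rfl⟩) (left_mem_segment ℝ p p)
  · rw [hF e he]
    exact Set.biUnion_subset_biUnion_left fun s hs => .inr (Set.mem_biUnion he hs)

/-! ### Free sectors at a point of a drawing -/

/-- The region of the plane in which gadgets are drawn. -/
def planeWedge : Set (ℝ × ℝ) := {p | 0 ≤ p.2 ∧ p.2 ≤ p.1 ∧ p.1 ≤ 1}

/-- A thin cone with apex `p` and given direction avoids a segment unless they are parallel. -/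
theorem eventually_cone_avoids_segment (p a b : ℝ × ℝ) (m : ℝ)
    (hm : m ≠ (b.2 - a.2) / (b.1 - a.1)) :
    ∀ᶠ τ in nhdsWithin (0 : ℝ) (Set.Ioi 0), ∀ x q : ℝ, 0 < x → x ≤ τ → m ≤ q → q ≤ m + τ →
      (p.1 + x, p.2 + x * q) ∉ segment ℝ a b := by
  by_cases hp : p ∈ segment ℝ a b
  · have hq : ∀ᶠ τ in nhdsWithin (0 : ℝ) (Set.Ioi 0), ∀ q, m ≤ q → q ≤ m + τ →
        q ≠ (b.2 - a.2) / (b.1 - a.1) := by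
      rcases lt_or_gt_of_ne hm with hlt | hgt
      · have : ∀ᶠ τ in nhdsWithin (0 : ℝ) (Set.Ioi 0), τ < (b.2 - a.2) / (b.1 - a.1) - m :=
          nhdsWithin_le_nhds (gt_mem_nhds (sub_pos.2 hlt))
        filter_upwards [this] with τ hτ q _ h2
        exact ne_of_lt (by linarith)
      · exact Filter.Eventually.of_forall fun τ q h1 _ => ne_of_gt (lt_of_lt_of_le hgt h1)
    filter_upwards [hq] with τ hτ x q hx _ h1 h2 hmem
    rw [segment_eq_image'] at hp hmem
    obtain ⟨s, -, rfl⟩ := hp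
    obtain ⟨t, -, ht⟩ := hmem
    have e1 := congrArg Prod.fst ht
    have e2 := congrArg Prod.snd ht
    simp only [Prod.fst_add, Prod.smul_fst, Prod.fst_sub, smul_eq_mul, Prod.snd_add, Prod.smul_snd,
      Prod.snd_sub] at e1 e2
    have hts : (t - s) * (b.1 - a.1) = x := by linarith
    -- For a vertical or degenerate segment the quotient in `hm` is the default `0`; this is
    -- harmless, since such a segment through `p` contains no point with `x > 0`.
    have hne : b.1 - a.1 ≠ 0 := by
      rintro h0
      rw [h0, mul_zero] at hts
      exact hx.ne hts
    have hts' : t - s ≠ 0 := by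
      rintro h0
      rw [h0, zero_mul] at hts
      exact hx.ne hts
    apply hτ q h1 h2
    rw [eq_div_iff hne]
    have : (t - s) * (b.2 - a.2) = (t - s) * ((b.1 - a.1) * q) := by
      rw [← mul_assoc, hts]
      linarith
    linarith [mul_left_cancel₀ hts' this]
  · have hcl : IsClosed (segment ℝ a b) := by
      rw [← Path.range_segment]
      exact (isCompact_range (Path.segment a b).continuous).isClosed
    obtain ⟨ε, hε, hball⟩ := Metric.isOpen_iff.1 hcl.isOpen_compl p hp
    have hpos : 0 < ε / (|m| + 2) := by positivity
    have h1 : ∀ᶠ τ in nhdsWithin (0 : ℝ) (Set.Ioi 0), τ < ε / (|m| + 2) :=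
      nhdsWithin_le_nhds (gt_mem_nhds hpos)
    have h2 : ∀ᶠ τ in nhdsWithin (0 : ℝ) (Set.Ioi 0), τ < 1 :=
      nhdsWithin_le_nhds (gt_mem_nhds one_pos)
    filter_upwards [h1, h2] with τ hτ hτ1 x q hx hxτ hq1 hq2
    apply hball
    have hxε : x * (|m| + 2) < ε := by
      rw [← lt_div_iff₀ (by positivity)]
      linarith
    have hq : |q| ≤ |m| + 1 := by
      rw [abs_le]
      constructor <;> linarith [neg_abs_le m, le_abs_self m]
    have habs := abs_nonneg m
    rw [Metric.mem_ball, Prod.dist_eq, max_lt_iff, Real.dist_eq, Real.dist_eq]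
    simp only [add_sub_cancel_left, abs_mul, abs_of_pos hx]
    constructor <;> nlinarith

/-- At each point there is room for an affine copy of the wedge. -/
theorem exists_wedge_at (F : Set ((ℝ × ℝ) × (ℝ × ℝ))) (hF : F.Finite) (p : ℝ × ℝ) :
    ∃ f : ℝ × ℝ →ᵃ[ℝ] ℝ × ℝ, Function.Injective f ∧ f (0, 0) = p ∧
      (⋃ s ∈ F, segment ℝ s.1 s.2) ∩ f '' planeWedge ⊆ {p} := by
  obtain ⟨m, hm⟩ := (hF.image fun s : (ℝ × ℝ) × (ℝ × ℝ) =>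
    (s.2.2 - s.1.2) / (s.2.1 - s.1.1)).exists_notMem
  have hev : ∀ᶠ τ in nhdsWithin (0 : ℝ) (Set.Ioi 0), ∀ s ∈ F, ∀ x q : ℝ, 0 < x → x ≤ τ → m ≤ q →
      q ≤ m + τ → (p.1 + x, p.2 + x * q) ∉ segment ℝ s.1 s.2 := by
    rw [Filter.eventually_all_finite hF]
    exact fun s hs => eventually_cone_avoids_segment p s.1 s.2 m
      fun h => hm ⟨s, hs, h.symm⟩
  obtain ⟨τ, hτ, hτ0⟩ := (hev.and self_mem_nhdsWithin).exists
  -- A wedge point `z` with `z.1 > 0` goes to offset `x = τ * z.1` and slope `q = m + τ * (z.2 /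
  -- z.1)`, that is, into the cone avoided by every segment.
  let L : ℝ × ℝ →ₗ[ℝ] ℝ × ℝ :=
    (τ • LinearMap.fst ℝ ℝ ℝ).prod
      ((τ * m) • LinearMap.fst ℝ ℝ ℝ + (τ ^ 2) • LinearMap.snd ℝ ℝ ℝ)
  let f : ℝ × ℝ →ᵃ[ℝ] ℝ × ℝ := L.toAffineMap + AffineMap.const ℝ (ℝ × ℝ) p
  have hf : ∀ z, f z = (p.1 + τ * z.1, p.2 + (τ * m * z.1 + τ ^ 2 * z.2)) := by
    intro z
    ext <;> simp [f, L, add_comm]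
  refine ⟨f, ?_, ?_, ?_⟩
  · intro z w h
    rw [hf, hf, Prod.mk.injEq] at h
    have h1 : z.1 = w.1 := mul_left_cancel₀ hτ0.ne' (by linarith [h.1])
    have h2 : z.2 = w.2 := by
      have := h.2
      rw [h1] at this
      exact mul_left_cancel₀ (pow_pos hτ0 2).ne' (by linarith)
    exact Prod.ext h1 h2
  · rw [hf]
    simp
  · rintro _ ⟨hmem, z, ⟨hz0, hzx, hz1⟩, rfl⟩
    obtain ⟨s, hs, hzs⟩ := Set.mem_iUnion₂.1 hmem
    rcases (hz0.trans hzx).eq_or_lt with hx | hx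
    · have h2 : z.2 = 0 := le_antisymm (hx ▸ hzx) hz0
      rw [hf, ← hx, h2]
      simp
    · exfalso
      have hle : z.2 / z.1 ≤ 1 := (div_le_one hx).2 hzx
      have hge : 0 ≤ z.2 / z.1 := by positivity
      refine hτ s hs (τ * z.1) (m + τ * (z.2 / z.1)) (by positivity) (by nlinarith)
        (by nlinarith [mul_nonneg hτ0.le hge]) (by nlinarith) ?_
      convert hzs using 1
      rw [hf]
      congr 2
      field_simp

/-! ### Walks of given length and odd-girth -/

namespace SimpleGraph

/-- There is a walk of length `l` from `u` to `v`. -/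
def HasWalk {V : Type*} (G : SimpleGraph V) (u v : V) (l : ℕ) : Prop :=
  ∃ w : G.Walk u v, w.length = l

section HasWalk

variable {V V' : Type*} {G H : SimpleGraph V} {G' : SimpleGraph V'} {u v w : V} {l m : ℕ}

theorem HasWalk.refl (u : V) : G.HasWalk u u 0 := ⟨.nil, rfl⟩

theorem Adj.hasWalk (h : G.Adj u v) : G.HasWalk u v 1 := ⟨h.toWalk, rfl⟩

theorem HasWalk.symm (h : G.HasWalk u v l) : G.HasWalk v u l := by
  obtain ⟨w, rfl⟩ := h
  exact ⟨w.reverse, w.length_reverse⟩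

theorem HasWalk.trans (h : G.HasWalk u v l) (h' : G.HasWalk v w m) : G.HasWalk u w (l + m) := by
  obtain ⟨p, rfl⟩ := h
  obtain ⟨q, rfl⟩ := h'
  exact ⟨p.append q, p.length_append q⟩

theorem HasWalk.map (h : G.HasWalk u v l) (f : G →g G') : G'.HasWalk (f u) (f v) l := by
  obtain ⟨p, rfl⟩ := h
  exact ⟨p.map f, p.length_map f⟩

theorem HasWalk.mono (h : G.HasWalk u v l) (hGH : G ≤ H) : H.HasWalk u v l :=
  h.map (Hom.ofLE hGH)

theorem HasWalk.induce {S : Set V} (h : G.HasWalk u v l) (hS : ∀ x y, G.Adj x y → x ∈ S)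
    (hu : u ∈ S) (hv : v ∈ S) : (G.induce S).HasWalk ⟨u, hu⟩ ⟨v, hv⟩ l := by
  obtain ⟨p, rfl⟩ := h
  induction p with
  | nil => exact .refl _
  | cons hadj p ih =>
    have hx := hS _ _ hadj.symm
    have h1 : (G.induce S).Adj ⟨_, hu⟩ ⟨_, hx⟩ := hadj
    rw [Walk.length_cons, add_comm]
    exact h1.hasWalk.trans (ih hx hv)

/-- A walk that is not a path contains a closed walk whose removal leaves a walk. -/
theorem Walk.exists_closed_of_not_isPath (p : G.Walk u v) (hp : ¬ p.IsPath) :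
    ∃ x l c, 0 < c ∧ G.HasWalk u v l ∧ G.HasWalk x x c ∧ l + c = p.length := by
  classical
  induction p with
  | nil => exact absurd .nil hp
  | @cons a b d hadj q ih =>
    by_cases hq : q.IsPath
    · have ha : a ∈ q.support := by
        by_contra h
        exact hp (hq.cons h)
      refine ⟨a, (q.dropUntil a ha).length, 1 + (q.takeUntil a ha).length, by omega, ⟨_, rfl⟩,
        hadj.hasWalk.trans ⟨_, rfl⟩, ?_⟩
      have := congrArg Walk.length (q.take_spec ha)
      rw [Walk.length_append] at this
      rw [Walk.length_cons]
      omega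
    · obtain ⟨x, l, c, h0, h1, h2, h3⟩ := ih hq
      refine ⟨x, 1 + l, c, h0, hadj.hasWalk.trans h1, h2, ?_⟩
      rw [Walk.length_cons]
      omega

/-- An odd closed walk is at least as long as some odd cycle. -/
theorem HasWalk.exists_odd_cycle (h : G.HasWalk u u l) (hl : Odd l) :
    ∃ (a : V) (w : G.Walk a a), w.IsCycle ∧ Odd w.length ∧ w.length ≤ l := by
  classical
  induction l using Nat.strong_induction_on generalizing u with
  | _ l ih =>
    obtain ⟨p, rfl⟩ := h
    cases p with
    | nil => simp at hl
    | @cons _ b _ hadj q =>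
      rw [Walk.length_cons] at hl ih ⊢
      by_cases hq : q.IsPath
      · refine ⟨_, .cons hadj q, ?_, by simpa using hl, by simp⟩
        refine (Walk.cons_isCycle_iff q hadj).2 ⟨hq, fun he => ?_⟩
        -- A path `q` can use the first edge only by being that edge alone, which makes the closed
        -- walk have even length 2.
        cases q with
        | nil => simp at he
        | @cons _ c _ hadj' r =>
          rw [Walk.cons_isPath_iff] at hq
          rw [Walk.edges_cons, List.mem_cons] at he
          rcases he with he | he
          · rw [Sym2.eq_iff] at he
            rcases he with ⟨h1, -⟩ | ⟨h1, -⟩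
            · exact hadj.ne h1
            · subst h1
              rw [(Walk.isPath_iff_nil.1 hq.1).eq_nil] at hl
              exact absurd hl (show ¬ Odd 2 by decide)
          · exact hq.2 (r.snd_mem_support_of_mem_edges he)
      · obtain ⟨x, l, c, h0, h1, h2, h3⟩ := q.exists_closed_of_not_isPath hq
        -- The odd closed walk splits into two shorter closed walks, exactly one of them odd; induct
        -- on that one.
        rcases Nat.even_or_odd c with hc | hc
        · obtain ⟨a, w, hw1, hw2, hw3⟩ := ih (1 + l) (by omega) (hadj.hasWalk.trans h1)
            (by rw [Nat.odd_iff] at *; rw [Nat.even_iff] at hc; omega)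
          exact ⟨a, w, hw1, hw2, by omega⟩
        · obtain ⟨a, w, hw1, hw2, hw3⟩ := ih c (by omega) h2 hc
          exact ⟨a, w, hw1, hw2, by omega⟩

theorem oddGirth_le_of_hasWalk (h : G.HasWalk u u l) (hl : Odd l) : G.oddGirth ≤ l := by
  obtain ⟨a, w, h1, h2, h3⟩ := h.exists_odd_cycle hl
  exact (iInf_le_of_le a (iInf_le_of_le w (iInf_le_of_le ⟨h1, h2⟩ le_rfl))).trans
    (Nat.cast_le.2 h3)

theorem le_oddGirth_iff {n : ℕ} :
    (n : ℕ∞) ≤ G.oddGirth ↔ ∀ a l, G.HasWalk a a l → Odd l → n ≤ l := by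
  constructor
  · intro h a l hw hl
    exact Nat.cast_le.1 (h.trans (oddGirth_le_of_hasWalk hw hl))
  · intro h
    refine le_iInf fun a => le_iInf fun w => le_iInf fun hw => ?_
    exact Nat.cast_le.2 (h a _ ⟨w, rfl⟩ hw.2)

theorem Hom.oddGirth_le (f : G →g G') : G'.oddGirth ≤ G.oddGirth :=
  le_iInf fun _ => le_iInf fun w => le_iInf fun hw =>
    oddGirth_le_of_hasWalk (HasWalk.map ⟨w, rfl⟩ f) hw.2

end HasWalk

end SimpleGraph

theorem IsPlanarBound.of_hom {k : ℕ} {V V' : Type*} {B : SimpleGraph V} {B' : SimpleGraph V'}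
    (h : IsPlanarBound k B) (f : B →g B') (g : B' →g B) : IsPlanarBound k B' :=
  ⟨by rw [← h.1]; exact le_antisymm f.oddGirth_le g.oddGirth_le,
    fun W _ G hG hG' => (h.2 W G hG hG').map f.comp⟩

/-! ### Projective cubes -/

section projectiveCube

open Finset

/-- The generators of the projective cube. -/
def cubeGen (d : ℕ) : Option (Fin d) → Fin d → ZMod 2
  | none => fun _ => 1
  | some i => Pi.single i 1

theorem cubeGen_ne_zero {d : ℕ} (hd : 1 ≤ d) (i : Option (Fin d)) : cubeGen d i ≠ 0 := by
  cases i with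
  | none => exact fun h => one_ne_zero (congrFun h ⟨0, hd⟩)
  | some i => exact fun h => by simpa [cubeGen] using congrFun h i

theorem cubeGen_add_self {d : ℕ} (i : Option (Fin d)) : cubeGen d i + cubeGen d i = 0 :=
  funext fun _ => CharTwo.add_self_eq_zero _

theorem sum_cubeGen (d : ℕ) : ∑ i, cubeGen d i = 0 := by
  rw [Fintype.sum_option]
  ext j
  simp only [cubeGen, Pi.add_apply, Finset.sum_apply, Finset.sum_pi_single, Pi.zero_apply]
  simpa using CharTwo.add_self_eq_zero (1 : ZMod 2)

theorem projectiveCube_adj_iff {d : ℕ} (hd : 1 ≤ d) {u v : Fin d → ZMod 2} :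
    (projectiveCube d).Adj u v ↔ ∃ i, v = u + cubeGen d i := by
  have hgen : ∀ g, g ∈ insert (fun _ => 1) (Set.range fun i : Fin d => Pi.single i (1 : ZMod 2)) ↔
      ∃ i, g = cubeGen d i := by
    intro g
    rw [Option.exists]
    simp [cubeGen, eq_comm]
  rw [projectiveCube, SimpleGraph.addCayley_adj']
  constructor
  · rintro ⟨-, g, hg, h⟩
    obtain ⟨i, rfl⟩ := (hgen g).1 hg
    refine ⟨i, ?_⟩
    rcases h with h | h
    · exact h.symm
    · rw [h, add_assoc, cubeGen_add_self, add_zero]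
  · rintro ⟨i, rfl⟩
    exact ⟨fun h => cubeGen_ne_zero hd i (by simpa using h), _, (hgen _).2 ⟨i, rfl⟩, .inl rfl⟩

theorem projectiveCube_hasWalk {d : ℕ} (hd : 1 ≤ d) (u : Fin d → ZMod 2)
    (R : Finset (Option (Fin d))) :
    (projectiveCube d).HasWalk u (u + ∑ i ∈ R, cubeGen d i) R.card := by
  classical
  induction R using Finset.induction_on with
  | empty => simpa using SimpleGraph.HasWalk.refl u
  | insert i R hi ih =>
    rw [card_insert_of_notMem hi, sum_insert hi]
    refine ih.trans (SimpleGraph.Adj.hasWalk ((projectiveCube_adj_iff hd).2 ⟨i, ?_⟩))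
    abel

/-- All `d + 1` generators sum to zero, so `R` and its complement lead to the same vertex. -/
theorem projectiveCube_hasWalk_compl {d : ℕ} (hd : 1 ≤ d) (u : Fin d → ZMod 2)
    (R : Finset (Option (Fin d))) :
    (projectiveCube d).HasWalk u (u + ∑ i ∈ R, cubeGen d i) (d + 1 - R.card) := by
  classical
  have h := projectiveCube_hasWalk hd u Rᶜ
  have hsum : ∑ i ∈ Rᶜ, cubeGen d i = ∑ i ∈ R, cubeGen d i := by
    have h0 := sum_add_sum_compl R (cubeGen d)
    have h1 : ∑ i ∈ R, cubeGen d i + ∑ i ∈ R, cubeGen d i = 0 := by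
      rw [← sum_add_distrib]
      exact sum_eq_zero fun i _ => cubeGen_add_self i
    rw [sum_cubeGen, ← h1] at h0
    exact add_left_cancel h0
  rwa [hsum, card_compl, Fintype.card_option, Fintype.card_fin] at h

/-- A walk is closed only if every generator is used with the same parity as `J`. An odd walk cannot
use them all evenly, so each of the `d + 1` generators occurs. -/
theorem le_of_odd_of_projectiveCube_hasWalk {d : ℕ} (hd : 1 ≤ d)
    {u : Fin d → ZMod 2} {l : ℕ} (h : (projectiveCube d).HasWalk u u l) (hl : Odd l) :
    d + 1 ≤ l := by
  have key : ∀ {u v : Fin d → ZMod 2} (w : (projectiveCube d).Walk u v),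
      ∃ c : Option (Fin d) → ℕ, ∑ i, c i = w.length ∧
        ∀ i, v i = u i + c (some i) + c none := by
    intro u v w
    induction w with
    | nil => exact ⟨0, by simp, by simp⟩
    | cons hadj p ih =>
      obtain ⟨c, hc, hv⟩ := ih
      obtain ⟨j, rfl⟩ := (projectiveCube_adj_iff hd).1 hadj
      refine ⟨c + Pi.single j 1, ?_, fun i => ?_⟩
      · simp [Finset.sum_add_distrib, hc]
      · rw [hv i]
        cases j with
        | none => simp [cubeGen]; ring
        | some j =>
          rcases eq_or_ne i j with rfl | hij
          · simp [cubeGen]; ring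
          · simp [cubeGen, hij]
  obtain ⟨w, rfl⟩ := h
  obtain ⟨c, hc, hv⟩ := key w
  have hpar : ∀ i, Even (c (some i) + c none) := by
    intro i
    have := hv i
    rw [add_assoc, left_eq_add] at this
    rw [← ZMod.natCast_eq_zero_iff_even]
    exact_mod_cast this
  rw [← hc, Fintype.sum_option] at hl ⊢
  rcases Nat.even_or_odd (c none) with h0 | h0
  · have : Even (∑ i, c (some i)) :=
      Finset.even_sum _ fun i _ => (Nat.even_add.1 (hpar i)).2 h0
    exact absurd hl (Nat.not_odd_iff_even.2 (h0.add this))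
  · have h1 : ∀ i, 1 ≤ c (some i) := fun i =>
      ((Nat.even_add'.1 (hpar i)).2 h0).pos
    have h2 : ∑ _i : Fin d, 1 ≤ ∑ i, c (some i) := Finset.sum_le_sum fun i _ => h1 i
    have h3 : 1 ≤ c none := h0.pos
    simp at h2
    omega

theorem le_oddGirth_projectiveCube {k : ℕ} (hk : 1 ≤ k) :
    ((2 * k + 1 : ℕ) : ℕ∞) ≤ (projectiveCube (2 * k)).oddGirth :=
  SimpleGraph.le_oddGirth_iff.2 fun _ _ hw hl =>
    le_of_odd_of_projectiveCube_hasWalk (by omega) hw hl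

theorem two_mul_ncard_edgeSet_projectiveCube_le {d : ℕ} (hd : 1 ≤ d) :
    2 * (projectiveCube d).edgeSet.ncard ≤ 2 ^ d * (d + 1) := by
  classical
  have hdeg : ∀ u, (projectiveCube d).degree u ≤ d + 1 := by
    intro u
    have hsub : (projectiveCube d).neighborFinset u ⊆
        (univ : Finset (Option (Fin d))).image fun i => u + cubeGen d i := by
      intro v hv
      obtain ⟨i, rfl⟩ := (projectiveCube_adj_iff hd).1 ((SimpleGraph.mem_neighborFinset ..).1 hv)
      exact mem_image_of_mem _ (mem_univ i)
    calc (projectiveCube d).degree u ≤ _ := card_le_card hsub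
      _ ≤ _ := card_image_le
      _ = d + 1 := by simp
  rw [← SimpleGraph.coe_edgeFinset, Set.ncard_coe_finset,
    ← SimpleGraph.sum_degrees_eq_twice_card_edges]
  calc _ ≤ ∑ _u : Fin d → ZMod 2, (d + 1) := Finset.sum_le_sum fun u _ => hdeg u
    _ = _ := by simp [ZMod.card]

end projectiveCube

/-! ### Gadgets and their recursion -/

theorem exists_isDrawnIn_edge {T : Type*} {Q : SimpleGraph T} {x y : T} (hxy : Q.Adj x y)
    {p q : ℝ × ℝ} (hpq : p ≠ q) :
    ∃ φ : ℝ × ℝ → T, φ p = x ∧ φ q = y ∧ IsDrawnIn Q (segment ℝ p q) {p, q}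
      (SimpleGraph.edge p q) φ (fun _ => segment ℝ p q) := by
  classical
  have h1 : (if p = p then x else y) = x := if_pos rfl
  have h2 : (if q = p then x else y) = y := if_neg hpq.symm
  exact ⟨fun w => if w = p then x else y, h1, h2, isDrawnIn_edge Q hpq
    (φ := fun w => if w = p then x else y) (by rw [h1, h2]; exact hxy)⟩

theorem edge_adj_of_ne {V : Type*} {p q : V} (h : p ≠ q) : (SimpleGraph.edge p q).Adj p q :=
  (SimpleGraph.edge_adj ..).2 ⟨.inl ⟨rfl, rfl⟩, h⟩

theorem eq_midpoint_of_mem_segments {p q z : ℝ × ℝ} (hpq : p ≠ q)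
    (h : z ∈ segment ℝ p (midpoint ℝ p q)) (h' : z ∈ segment ℝ (midpoint ℝ p q) q) :
    z = midpoint ℝ p q := by
  rw [segment_eq_image_lineMap] at h h'
  obtain ⟨a, ha, rfl⟩ := h
  obtain ⟨b, hb, hab⟩ := h'
  have e1 : midpoint ℝ p q = AffineMap.lineMap p q (1 / 2 : ℝ) := by
    rw [midpoint, one_div, invOf_eq_inv]
  have e2 : AffineMap.lineMap p (midpoint ℝ p q) a = AffineMap.lineMap p q (a / 2) := by
    rw [e1]
    ext <;> simp [AffineMap.lineMap_apply] <;> ring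
  have e3 : AffineMap.lineMap (midpoint ℝ p q) q b = AffineMap.lineMap p q ((1 + b) / 2) := by
    rw [e1]
    ext <;> simp [AffineMap.lineMap_apply] <;> ring
  rw [e2, e3] at hab
  have := AffineMap.lineMap_injective ℝ hpq hab
  have ha1 : a = 1 := by linarith [ha.2, hb.1]
  simp [ha1]

/-- A walk of the target graph can be realised as a path drawn on a given segment. -/
theorem exists_isDrawnIn_path {T : Type*} {Q : SimpleGraph T} (l : ℕ) {x y : T}
    (hw : Q.HasWalk x y (l + 1)) {p q : ℝ × ℝ} (hpq : p ≠ q) :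
    ∃ V G φ arc, IsDrawnIn Q (segment ℝ p q) V G φ arc ∧ p ∈ V ∧ q ∈ V ∧ φ p = x ∧ φ q = y ∧
      G.HasWalk p q (l + 1) := by
  induction l generalizing x p with
  | zero =>
    obtain ⟨w, hw⟩ := hw
    obtain ⟨φ, h1, h2, hd⟩ := exists_isDrawnIn_edge (w.adj_of_length_eq_one hw) hpq
    exact ⟨_, _, φ, _, hd, by simp, by simp, h1, h2, (edge_adj_of_ne hpq).hasWalk⟩
  | succ l ih =>
    obtain ⟨w, hw⟩ := hw
    cases w with
    | nil => simp at hw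
    | @cons _ z _ hadj w' =>
      rw [SimpleGraph.Walk.length_cons] at hw
      have hpm : p ≠ midpoint ℝ p q := by rwa [ne_eq, left_eq_midpoint_iff]
      have hmq : midpoint ℝ p q ≠ q := by rwa [ne_eq, midpoint_eq_right_iff]
      have hm : midpoint ℝ p q ∈ segment ℝ p q := midpoint_mem_segment p q
      obtain ⟨φ₁, h1, h2, hd₁⟩ := exists_isDrawnIn_edge hadj hpm
      obtain ⟨V, G, φ₂, arc, hd₂, hmV, hqV, h3, h4, hG⟩ := ih ⟨w', by omega⟩ hmq
      obtain ⟨φ, arc', h5, h6, hd⟩ := hd₁.union hd₂ (fun z hz hz' => by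
        rw [eq_midpoint_of_mem_segments hpq hz hz']
        exact ⟨by simp, hmV, h2.trans h3.symm⟩)
      refine ⟨_, _, φ, arc', hd.mono (Set.union_subset ?_ ?_), by simp, .inr hqV,
        (h5 p (by simp)).trans h1, (h6 q hqV).trans h4, ?_⟩
      · exact (convex_segment p q).segment_subset (left_mem_segment ..) hm
      · exact (convex_segment p q).segment_subset hm (right_mem_segment ..)
      · rw [add_comm (l + 1)]
        exact ((edge_adj_of_ne hpm).hasWalk.mono le_sup_left).trans (hG.mono le_sup_right)

/-- A plane graph with two poles `s` and `t`, labelled by vertices of the projective cube. It has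
`2 ^ r` selected vertices, each on a walk of length `r` from `s` to `t`, among them `s`, `t` and `r`
neighbours of `s`. Any two of them are joined by a short odd walk as soon as the poles are joined by
a walk of length `2 * k + 1 - r`. -/
structure Gadget (k r : ℕ) (K : Set (ℝ × ℝ)) (s t : ℝ × ℝ) (α β : Fin (2 * k) → ZMod 2) where
  /-- The vertices. -/
  V : Set (ℝ × ℝ)
  /-- The graph. -/
  G : SimpleGraph (ℝ × ℝ)
  /-- The labels. -/
  φ : ℝ × ℝ → Fin (2 * k) → ZMod 2
  /-- The arcs. -/
  arc : Sym2 (ℝ × ℝ) → Set (ℝ × ℝ)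
  drawn : IsDrawnIn (projectiveCube (2 * k)) K V G φ arc
  s_mem : s ∈ V
  t_mem : t ∈ V
  φ_s : φ s = α
  φ_t : φ t = β
  /-- The index type of the selected vertices. -/
  ι : Type
  [fintype : Fintype ι]
  card_ι : Fintype.card ι = 2 ^ r
  /-- The selected vertices. -/
  v : ι → ℝ × ℝ
  v_mem : ∀ i, v i ∈ V
  /-- The distance from `s`. -/
  depth : ι → ℕ
  depth_le : ∀ i, depth i ≤ r
  walk_s : ∀ i, G.HasWalk (v i) s (depth i)
  walk_t : ∀ i, G.HasWalk (v i) t (r - depth i)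
  /-- The index of `s`. -/
  is : ι
  /-- The index of `t`. -/
  it : ι
  v_is : v is = s
  v_it : v it = t
  is_ne_it : is ≠ it
  /-- The indices of some neighbours of `s`. -/
  N : Finset ι
  card_N : N.card = r
  adj : ∀ i ∈ N, G.Adj s (v i)
  it_notMem : 2 ≤ r → it ∉ N
  clique : ∀ G', G ≤ G' → G'.HasWalk s t (2 * k + 1 - r) → ∀ i j, i ≠ j →
    ∃ l, Odd l ∧ l < 2 * k ∧ G'.HasWalk (v i) (v j) l

theorem nonempty_gadget_one {k : ℕ} (hk : 1 ≤ k) {s t : ℝ × ℝ} {α β : Fin (2 * k) → ZMod 2}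
    (hst : s ≠ t) (hαβ : (projectiveCube (2 * k)).Adj α β) :
    Nonempty (Gadget k 1 (segment ℝ s t) s t α β) := by
  obtain ⟨φ, h1, h2, hd⟩ := exists_isDrawnIn_edge hαβ hst
  have hadj := edge_adj_of_ne hst
  refine ⟨{
    V := _, G := _, φ := φ, arc := _, drawn := hd
    s_mem := by simp, t_mem := by simp, φ_s := h1, φ_t := h2
    ι := Bool, card_ι := by simp
    v := fun i => if i then t else s
    v_mem := by rintro (_ | _) <;> simp
    depth := fun i => if i then 1 else 0
    depth_le := by rintro (_ | _) <;> simp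
    walk_s := ?_, walk_t := ?_
    is := false, it := true, v_is := by simp, v_it := by simp, is_ne_it := by simp
    -- In rank 1 the only neighbour of `s` is `t` itself; this is why `it_notMem` starts at rank 2.
    N := {true}, card_N := by simp, adj := by simpa using hadj
    it_notMem := by simp
    clique := ?_ }⟩
  · rintro (_ | _)
    · simpa using SimpleGraph.HasWalk.refl s
    · simpa using hadj.symm.hasWalk
  · rintro (_ | _)
    · simpa using hadj.hasWalk
    · simpa using SimpleGraph.HasWalk.refl t
  · intro G' hG' _ i j hij
    refine ⟨1, odd_one, by omega, ?_⟩
    rcases i with _ | _ <;> rcases j with _ | _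
    · exact absurd rfl hij
    · simpa using hadj.hasWalk.mono hG'
    · simpa using hadj.symm.hasWalk.mono hG'
    · exact absurd rfl hij

theorem SimpleGraph.HasWalk.cast {V : Type*} {G : SimpleGraph V} {u v : V} {l m : ℕ}
    (h : G.HasWalk u v l) (e : l = m) : G.HasWalk u v m := e ▸ h

/-- The recursive construction of gadgets. -/
theorem nonempty_gadget_succ {k r : ℕ} (hrk : r + 1 ≤ 2 * k)
    {K₁ K₂ : Set (ℝ × ℝ)} {s t a b : ℝ × ℝ} {α β α' β' : Fin (2 * k) → ZMod 2}
    (hsa : s ≠ a) (hab : a ≠ b) (hbt : b ≠ t)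
    (h₁ : (projectiveCube (2 * k)).Adj α α') (h₂ : (projectiveCube (2 * k)).Adj β' β)
    (h₃ : (projectiveCube (2 * k)).HasWalk α' β' (2 * k - r))
    (hK₁ : ∀ p ∈ segment ℝ s a, p ∈ segment ℝ a b → p = a)
    (hK₂ : ∀ p ∈ segment ℝ s a ∪ segment ℝ a b, p ∈ segment ℝ b t → p = b)
    (hK₃ : ∀ p ∈ segment ℝ s a ∪ segment ℝ a b ∪ segment ℝ b t, p ∈ K₁ → p = s ∨ p = b)
    (hK₄ : ∀ p ∈ segment ℝ s a ∪ segment ℝ a b ∪ segment ℝ b t ∪ K₁, p ∈ K₂ → p = a ∨ p = t)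
    (X : Gadget k r K₁ s b α β') (Y : Gadget k r K₂ a t α' β) :
    Nonempty (Gadget k (r + 1) (segment ℝ s a ∪ segment ℝ a b ∪ segment ℝ b t ∪ K₁ ∪ K₂)
      s t α β) := by
  obtain ⟨φ₁, a1, a2, d₁⟩ := exists_isDrawnIn_edge h₁ hsa
  obtain ⟨l, hl⟩ : ∃ l, 2 * k - r = l + 1 := ⟨2 * k - r - 1, by omega⟩
  rw [hl] at h₃
  obtain ⟨V₃, G₃, φ₃, arc₃, d₃, haV₃, hbV₃, a3, a4, w₃⟩ := exists_isDrawnIn_path l h₃ hab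
  obtain ⟨φ₂, a5, a6, d₂⟩ := exists_isDrawnIn_edge h₂ hbt
  obtain ⟨ψ₁, arc₁, b1, b2, e₁⟩ := d₁.union d₃ (fun p hp hp' => by
    rw [hK₁ p hp hp']
    exact ⟨by simp, haV₃, a2.trans a3.symm⟩)
  obtain ⟨ψ₂, arc₂, b3, b4, e₂⟩ := e₁.union d₂ (fun p hp hp' => by
    rw [hK₂ p hp hp']
    exact ⟨.inr hbV₃, by simp, by rw [b2 b hbV₃, a4, a5]⟩)
  have s_mem₁ : s ∈ ({s, a} ∪ V₃ : Set (ℝ × ℝ)) := .inl (by simp)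
  have a_mem₁ : a ∈ ({s, a} ∪ V₃ : Set (ℝ × ℝ)) := .inl (by simp)
  have b_mem₁ : b ∈ ({s, a} ∪ V₃ : Set (ℝ × ℝ)) := .inr hbV₃
  have t_mem₂ : t ∈ ({b, t} : Set (ℝ × ℝ)) := by simp
  have ψ₂s : ψ₂ s = α := by rw [b3 s s_mem₁, b1 s (by simp), a1]
  have ψ₂a : ψ₂ a = α' := by rw [b3 a a_mem₁, b1 a (by simp), a2]
  have ψ₂b : ψ₂ b = β' := by rw [b3 b b_mem₁, b2 b hbV₃, a4]
  have ψ₂t : ψ₂ t = β := by rw [b4 t t_mem₂, a6]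
  obtain ⟨ψ₃, arc₃, b5, b6, e₃⟩ := e₂.union X.drawn (fun p hp hp' => by
    rcases hK₃ p hp hp' with rfl | rfl
    · exact ⟨.inl s_mem₁, X.s_mem, by rw [ψ₂s, X.φ_s]⟩
    · exact ⟨.inl b_mem₁, X.t_mem, by rw [ψ₂b, X.φ_t]⟩)
  obtain ⟨ψ, arc, b7, b8, e⟩ := e₃.union Y.drawn (fun p hp hp' => by
    rcases hK₄ p hp hp' with rfl | rfl
    · exact ⟨.inl (.inl a_mem₁), Y.s_mem, by rw [b5 _ (.inl a_mem₁), ψ₂a, Y.φ_s]⟩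
    · exact ⟨.inl (.inr t_mem₂), Y.t_mem, by rw [b5 _ (.inr t_mem₂), ψ₂t, Y.φ_t]⟩)
  set G := SimpleGraph.edge s a ⊔ G₃ ⊔ SimpleGraph.edge b t ⊔ X.G ⊔ Y.G with hG
  have leY : Y.G ≤ G := le_sup_right
  have leX : X.G ≤ G := le_sup_right.trans le_sup_left
  have adj_sa : G.Adj s a := .inl (.inl (.inl (.inl (edge_adj_of_ne hsa))))
  have adj_bt : G.Adj b t := .inl (.inl (.inr (edge_adj_of_ne hbt)))
  have walk_ab : G.HasWalk a b (2 * k - r) := by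
    rw [hl]
    exact w₃.mono (le_sup_right.trans (le_sup_left.trans (le_sup_left.trans le_sup_left)))
  let _ := X.fintype
  let _ := Y.fintype
  have cross : ∀ G', G ≤ G' → G'.HasWalk s t (2 * k + 1 - (r + 1)) → ∀ i j,
      ∃ l, Odd l ∧ l < 2 * k ∧ G'.HasWalk (X.v i) (Y.v j) l := by
    intro G' hG' hst i j
    have hi := X.depth_le i
    have hj := Y.depth_le j
    have Xs := ((X.walk_s i).mono leX).mono hG'
    have Xb := ((X.walk_t i).mono leX).mono hG'
    have Ya := (((Y.walk_s j).mono leY).mono hG').symm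
    have Yt := (((Y.walk_t j).mono leY).mono hG').symm
    -- With depths `d` and `e`, the four walks have lengths `d + e + 1`, `2r - d - e + 1`, `2k - d +
    -- e` and `2k + d - e`. For `d + e` even the first two are odd with sum at most `4k`; otherwise
    -- the last two are odd with sum `4k`. Being odd, the shorter one is below `2k`.
    have r1 := (Xs.trans (adj_sa.hasWalk.mono hG')).trans Ya
    have r2 := (Xb.trans (adj_bt.hasWalk.mono hG')).trans Yt
    have r3 := (Xb.trans (walk_ab.mono hG').symm).trans Ya
    have r4 := (Xs.trans hst).trans Yt
    rcases Nat.even_or_odd' (X.depth i + Y.depth j) with ⟨c, hc | hc⟩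
    · by_cases hle : c + c < 2 * k
      · exact ⟨_, ⟨c, by omega⟩, by omega, r1⟩
      · refine ⟨_, ⟨r - c, ?_⟩, ?_, r2⟩ <;> omega
    · by_cases hle : X.depth i < Y.depth j
      · refine ⟨_, ?_, ?_, r4⟩
        · rw [Nat.odd_iff]
          omega
        · omega
      · refine ⟨_, ?_, ?_, r3⟩
        · rw [Nat.odd_iff]
          omega
        · omega
  refine ⟨{
    V := _, G := G, φ := ψ, arc := arc, drawn := e
    s_mem := .inl (.inl (.inl s_mem₁)), t_mem := .inr Y.t_mem
    φ_s := by rw [b7 s (.inl (.inl s_mem₁)), b5 s (.inl s_mem₁), ψ₂s]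
    φ_t := by rw [b8 t Y.t_mem, Y.φ_t]
    ι := X.ι ⊕ Y.ι
    card_ι := by rw [Fintype.card_sum, X.card_ι, Y.card_ι, pow_succ, mul_two]
    v := Sum.elim X.v Y.v
    v_mem := ?_
    depth := Sum.elim X.depth fun j => Y.depth j + 1
    depth_le := ?_
    walk_s := ?_, walk_t := ?_
    is := .inl X.is, it := .inr Y.it, v_is := X.v_is, v_it := Y.v_it, is_ne_it := by simp
    -- The new neighbour of `s` is `a`, the first pole of `Y`.
    N := X.N.disjSum {Y.is}
    card_N := by simp [X.card_N]
    adj := ?_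
    it_notMem := fun _ => by simpa using Y.is_ne_it.symm
    clique := ?_ }⟩
  · rintro (i | j)
    · exact .inl (.inr (X.v_mem i))
    · exact .inr (Y.v_mem j)
  · rintro (i | j)
    · exact (X.depth_le i).trans r.le_succ
    · exact Nat.succ_le_succ (Y.depth_le j)
  · rintro (i | j)
    · exact (X.walk_s i).mono leX
    · exact ((Y.walk_s j).mono leY).trans adj_sa.symm.hasWalk
  · rintro (i | j)
    · have := X.depth_le i
      exact (((X.walk_t i).mono leX).trans adj_bt.hasWalk).cast (by simp; omega)
    · exact ((Y.walk_t j).mono leY).cast (by simp)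
  · rintro (i | j) hi
    · exact leX (X.adj i (Finset.inl_mem_disjSum.1 hi))
    · rw [Finset.mem_singleton.1 (Finset.inr_mem_disjSum.1 hi), Sum.elim_inr, Y.v_is]
      exact adj_sa
  · rintro G' hG' hst (i | i) (j | j) hij
    -- The closing walk that `X` needs between its poles `s` and `b` runs through `a`.
    · refine X.clique G' (leX.trans hG') ?_ i j fun h => hij (h ▸ rfl)
      exact ((adj_sa.hasWalk.trans walk_ab).mono hG').cast (by omega)
    · exact cross G' hG' hst i j
    · obtain ⟨l, h1, h2, h3⟩ := cross G' hG' hst j i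
      exact ⟨l, h1, h2, h3.symm⟩
    · refine Y.clique G' (leY.trans hG') ?_ i j fun h => hij (h ▸ rfl)
      exact ((walk_ab.trans adj_bt.hasWalk).mono hG').cast (by omega)

/-! ### Nested triangles: drawing the gadgets -/

/-- The triangle in which gadgets with poles `(0, 0)` and `(1, 0)` are drawn. -/
def lens : Set (ℝ × ℝ) := {p | 0 ≤ p.2 ∧ p.2 ≤ p.1 ∧ p.2 ≤ 1 - p.1}

/-- The part of the triangle that meets the segment between the poles only in the poles. -/
def bentLens : Set (ℝ × ℝ) := {p | p ∈ lens ∧ (p.1 ≤ 2 * p.2 ∨ 1 - p.1 ≤ 2 * p.2)}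

/-- The affine map that places the lens along the segment from `(0, 0)` to `(1/2, 1/4)`. -/
noncomputable def lensLeft : ℝ × ℝ →ᵃ[ℝ] ℝ × ℝ :=
  (((1 / 2 : ℝ) • LinearMap.fst ℝ ℝ ℝ).prod
    ((1 / 4 : ℝ) • LinearMap.fst ℝ ℝ ℝ + (1 / 8 : ℝ) • LinearMap.snd ℝ ℝ ℝ)).toAffineMap

/-- The affine map that places the lens along the segment from `(1/2, 1/2)` to `(1, 0)`. -/
noncomputable def lensRight : ℝ × ℝ →ᵃ[ℝ] ℝ × ℝ :=
  (((1 / 2 : ℝ) • LinearMap.fst ℝ ℝ ℝ).prod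
    ((-1 / 2 : ℝ) • LinearMap.fst ℝ ℝ ℝ + (-1 / 8 : ℝ) • LinearMap.snd ℝ ℝ ℝ)).toAffineMap +
    AffineMap.const ℝ (ℝ × ℝ) (1 / 2, 1 / 2)

theorem lensLeft_apply (z : ℝ × ℝ) :
    lensLeft z = (1 / 2 * z.1, 1 / 4 * z.1 + 1 / 8 * z.2) := by
  ext <;> simp [lensLeft]

theorem lensRight_apply (z : ℝ × ℝ) :
    lensRight z = (1 / 2 * z.1 + 1 / 2, -1 / 2 * z.1 + -1 / 8 * z.2 + 1 / 2) := by
  ext <;> simp [lensRight]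

theorem lensLeft_injective : Function.Injective lensLeft := by
  intro z w h
  rw [lensLeft_apply, lensLeft_apply, Prod.mk.injEq] at h
  exact Prod.ext (by linarith [h.1]) (by linarith [h.1, h.2])

theorem lensRight_injective : Function.Injective lensRight := by
  intro z w h
  rw [lensRight_apply, lensRight_apply, Prod.mk.injEq] at h
  exact Prod.ext (by linarith [h.1]) (by linarith [h.1, h.2])

theorem mem_lensLeft {p : ℝ × ℝ} (h : p ∈ lensLeft '' lens) :
    p.1 ≤ 2 * p.2 ∧ 4 * p.2 ≤ 3 * p.1 ∧ 8 * p.2 ≤ 1 + 2 * p.1 := by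
  obtain ⟨z, ⟨h0, h1, h2⟩, rfl⟩ := h
  rw [lensLeft_apply]
  refine ⟨?_, ?_, ?_⟩ <;> simp only <;> linarith

theorem mem_lensRight {p : ℝ × ℝ} (h : p ∈ lensRight '' lens) :
    p.2 ≤ 1 - p.1 ∧ 3 * (1 - p.1) ≤ 4 * p.2 ∧ 8 * (1 - p.1 - p.2) ≤ 2 * p.1 - 1 := by
  obtain ⟨z, ⟨h0, h1, h2⟩, rfl⟩ := h
  rw [lensRight_apply]
  refine ⟨?_, ?_, ?_⟩ <;> simp only <;> linarith

theorem mem_segment_prod {p a b : ℝ × ℝ} (h : p ∈ segment ℝ a b) :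
    ∃ t : ℝ, 0 ≤ t ∧ t ≤ 1 ∧ p.1 = a.1 + t * (b.1 - a.1) ∧ p.2 = a.2 + t * (b.2 - a.2) := by
  rw [segment_eq_image'] at h
  obtain ⟨t, ht, rfl⟩ := h
  exact ⟨t, ht.1, ht.2, by simp, by simp⟩

theorem mem_image_of_injective_inter {f : ℝ × ℝ → ℝ × ℝ} (hf : Function.Injective f)
    {A B : Set (ℝ × ℝ)} {p : ℝ × ℝ} (hA : p ∈ f '' A) (hB : p ∈ f '' B) :
    ∃ z ∈ A, z ∈ B ∧ f z = p := by
  obtain ⟨z, hz, rfl⟩ := hA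
  exact ⟨z, hz, (hf.mem_set_image).1 hB, rfl⟩

/-- Here `a = (1/2, 1/2)` and `b = (1/2, 1/4)`, up to `f`. Both edges `sa` and `bt` carry one
generator `c` of `R`, both smaller gadgets carry the rest, and the path from `a` to `b` carries the
complement of `R`. The conclusion keeps the smaller region `bentLens`, so that a straight edge
between the poles can still be added. -/
theorem nonempty_gadget_bentLens {k r : ℕ} (hrk : r + 1 ≤ 2 * k)
    (ih : ∀ R : Finset (Option (Fin (2 * k))), R.card = r → ∀ f : ℝ × ℝ →ᵃ[ℝ] ℝ × ℝ,
      Function.Injective f → ∀ α : Fin (2 * k) → ZMod 2,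
        Nonempty (Gadget k r (f '' lens) (f (0, 0)) (f (1, 0)) α (α + ∑ i ∈ R, cubeGen (2 * k) i)))
    (R : Finset (Option (Fin (2 * k)))) (hR : R.card = r + 1) (f : ℝ × ℝ →ᵃ[ℝ] ℝ × ℝ)
    (hf : Function.Injective f) (α : Fin (2 * k) → ZMod 2) :
    Nonempty (Gadget k (r + 1) (f '' bentLens) (f (0, 0)) (f (1, 0)) α
      (α + ∑ i ∈ R, cubeGen (2 * k) i)) := by
  classical
  obtain ⟨c, R', hc, rfl, hR'⟩ := Finset.card_eq_succ.1 hR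
  have hk : 1 ≤ 2 * k := by omega
  obtain ⟨X⟩ := ih R' hR' (f.comp lensLeft) (hf.comp lensLeft_injective) α
  obtain ⟨Y⟩ := ih R' hR' (f.comp lensRight) (hf.comp lensRight_injective) (α + cubeGen (2 * k) c)
  rw [AffineMap.coe_comp, Set.image_comp, Function.comp_apply, Function.comp_apply,
    show lensLeft (0, 0) = (0, 0) by simp [lensLeft_apply],
    show lensLeft (1, 0) = (1 / 2, 1 / 4) by simp [lensLeft_apply]] at X
  rw [AffineMap.coe_comp, Set.image_comp, Function.comp_apply, Function.comp_apply,
    show lensRight (0, 0) = (1 / 2, 1 / 2) by simp [lensRight_apply],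
    show lensRight (1, 0) = (1, 0) by simp [lensRight_apply]; norm_num] at Y
  have hsum : α + ∑ i ∈ insert c R', cubeGen (2 * k) i =
      α + cubeGen (2 * k) c + ∑ i ∈ R', cubeGen (2 * k) i := by
    rw [Finset.sum_insert hc, add_assoc]
  have h₃ : (projectiveCube (2 * k)).HasWalk (α + cubeGen (2 * k) c)
      (α + ∑ i ∈ R', cubeGen (2 * k) i) (2 * k - r) := by
    have h := projectiveCube_hasWalk_compl hk (α + cubeGen (2 * k) c) (insert c R')
    rw [Finset.sum_insert hc, hR, add_assoc, ← add_assoc (cubeGen _ c), cubeGen_add_self,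
      zero_add] at h
    exact h.cast (by omega)
  rw [← hsum] at Y
  have hne : ∀ p q : ℝ × ℝ, p.2 ≠ q.2 → f p ≠ f q := fun p q h e => h (congrArg Prod.snd (hf e))
  have key := fun h1 h2 h3 h4 => nonempty_gadget_succ hrk (hne (0, 0) (1 / 2, 1 / 2) (by norm_num))
    (hne (1 / 2, 1 / 2) (1 / 2, 1 / 4) (by norm_num)) (hne (1 / 2, 1 / 4) (1, 0) (by norm_num))
    ((projectiveCube_adj_iff hk).2 ⟨c, rfl⟩)
    ((projectiveCube_adj_iff hk).2 ⟨c, by rw [hsum]; abel⟩) h₃ h1 h2 h3 h4 X Y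
  simp only [← image_segment, ← Set.image_union] at key
  have hinj : ∀ {A B : Set (ℝ × ℝ)} {q : ℝ × ℝ}, (∀ z ∈ A, z ∈ B → z = q) →
      ∀ p ∈ f '' A, p ∈ f '' B → p = f q := by
    intro A B q h p hA hB
    obtain ⟨z, h1, h2, rfl⟩ := mem_image_of_injective_inter hf hA hB
    rw [h z h1 h2]
  have hinj' : ∀ {A B : Set (ℝ × ℝ)} {q q' : ℝ × ℝ}, (∀ z ∈ A, z ∈ B → z = q ∨ z = q') →
      ∀ p ∈ f '' A, p ∈ f '' B → p = f q ∨ p = f q' := by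
    intro A B q q' h p hA hB
    obtain ⟨z, h1, h2, rfl⟩ := mem_image_of_injective_inter hf hA hB
    exact (h z h1 h2).imp (congrArg f) (congrArg f)
  have m1 : ∀ z ∈ segment ℝ ((0, 0) : ℝ × ℝ) (1 / 2, 1 / 2),
      z.1 = z.2 ∧ 0 ≤ z.1 ∧ z.1 ≤ 1 / 2 := by
    intro z hz
    obtain ⟨t, h0, h1, h2, h3⟩ := mem_segment_prod hz
    simp only at h2 h3
    refine ⟨?_, ?_, ?_⟩ <;> linarith
  have m2 : ∀ z ∈ segment ℝ ((1 / 2, 1 / 2) : ℝ × ℝ) (1 / 2, 1 / 4),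
      z.1 = 1 / 2 ∧ 1 / 4 ≤ z.2 ∧ z.2 ≤ 1 / 2 := by
    intro z hz
    obtain ⟨t, h0, h1, h2, h3⟩ := mem_segment_prod hz
    simp only at h2 h3
    refine ⟨?_, ?_, ?_⟩ <;> linarith
  have m3 : ∀ z ∈ segment ℝ ((1 / 2, 1 / 4) : ℝ × ℝ) (1, 0),
      2 * z.2 = 1 - z.1 ∧ 1 / 2 ≤ z.1 ∧ z.1 ≤ 1 := by
    intro z hz
    obtain ⟨t, h0, h1, h2, h3⟩ := mem_segment_prod hz
    simp only at h2 h3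
    refine ⟨?_, ?_, ?_⟩ <;> linarith
  have hext : ∀ (z : ℝ × ℝ) (x y : ℝ), z.1 ≤ x → x ≤ z.1 → z.2 ≤ y → y ≤ z.2 → z = (x, y) :=
    fun z x y h1 h2 h3 h4 => Prod.ext (le_antisymm h1 h2) (le_antisymm h3 h4)
  refine (key (hinj ?_) (hinj ?_) (hinj' ?_) (hinj' ?_)).elim fun Z => ?_
  · intro z hz hz'
    obtain ⟨h1, h2, h3⟩ := m1 z hz
    obtain ⟨h4, h5, h6⟩ := m2 z hz'
    apply hext <;> linarith
  · rintro z (hz | hz) hz'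
    · obtain ⟨h1, h2, h3⟩ := m1 z hz
      obtain ⟨h4, h5, h6⟩ := m3 z hz'
      apply hext <;> linarith
    · obtain ⟨h1, h2, h3⟩ := m2 z hz
      obtain ⟨h4, h5, h6⟩ := m3 z hz'
      apply hext <;> linarith
  · rintro z ((hz | hz) | hz) hz'
    · obtain ⟨h1, h2, h3⟩ := m1 z hz
      obtain ⟨h4, h5, h6⟩ := mem_lensLeft hz'
      left
      apply hext <;> linarith
    · obtain ⟨h1, h2, h3⟩ := m2 z hz
      obtain ⟨h4, h5, h6⟩ := mem_lensLeft hz'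
      right
      apply hext <;> linarith
    · obtain ⟨h1, h2, h3⟩ := m3 z hz
      obtain ⟨h4, h5, h6⟩ := mem_lensLeft hz'
      right
      apply hext <;> linarith
  · rintro z (((hz | hz) | hz) | hz) hz'
    · obtain ⟨h1, h2, h3⟩ := m1 z hz
      obtain ⟨h4, h5, h6⟩ := mem_lensRight hz'
      left
      apply hext <;> linarith
    · obtain ⟨h1, h2, h3⟩ := m2 z hz
      obtain ⟨h4, h5, h6⟩ := mem_lensRight hz'
      left
      apply hext <;> linarith
    · obtain ⟨h1, h2, h3⟩ := m3 z hz
      obtain ⟨h4, h5, h6⟩ := mem_lensRight hz'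
      right
      apply hext <;> linarith
    -- The two small triangles are disjoint: the inequalities are contradictory, and either
    -- alternative would do.
    · obtain ⟨h1, h2, h3⟩ := mem_lensLeft hz
      obtain ⟨h4, h5, h6⟩ := mem_lensRight hz'
      left
      apply hext <;> linarith
  · refine ⟨{ Z with drawn := Z.drawn.mono (Set.image_mono ?_) }⟩
    rintro z ((((hz | hz) | hz) | hz) | hz)
    · obtain ⟨h1, h2, h3⟩ := m1 z hz
      exact ⟨⟨by linarith, by linarith, by linarith⟩, .inl (by linarith)⟩
    · obtain ⟨h1, h2, h3⟩ := m2 z hz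
      exact ⟨⟨by linarith, by linarith, by linarith⟩, .inl (by linarith)⟩
    · obtain ⟨h1, h2, h3⟩ := m3 z hz
      exact ⟨⟨by linarith, by linarith, by linarith⟩, .inr (by linarith)⟩
    · obtain ⟨h1, h2, h3⟩ := mem_lensLeft hz
      exact ⟨⟨by linarith, by linarith, by linarith⟩, .inl (by linarith)⟩
    · obtain ⟨h1, h2, h3⟩ := mem_lensRight hz
      exact ⟨⟨by linarith, by linarith, by linarith⟩, .inr (by linarith)⟩

theorem nonempty_gadget_lens {k r : ℕ} (hr : 1 ≤ r) (hrk : r ≤ 2 * k)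
    (R : Finset (Option (Fin (2 * k)))) (hR : R.card = r) (f : ℝ × ℝ →ᵃ[ℝ] ℝ × ℝ)
    (hf : Function.Injective f) (α : Fin (2 * k) → ZMod 2) :
    Nonempty (Gadget k r (f '' lens) (f (0, 0)) (f (1, 0)) α
      (α + ∑ i ∈ R, cubeGen (2 * k) i)) := by
  induction r, hr using Nat.le_induction generalizing R f α with
  | base =>
    obtain ⟨c, rfl⟩ := Finset.card_eq_one.1 hR
    rw [Finset.sum_singleton]
    obtain ⟨Z⟩ := nonempty_gadget_one (k := k) (s := f (0, 0)) (t := f (1, 0)) (by omega)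
      (fun e => by simpa using hf e)
      ((projectiveCube_adj_iff (u := α) (by omega)).2 ⟨c, rfl⟩)
    refine ⟨{ Z with drawn := Z.drawn.mono ?_ }⟩
    rw [← image_segment]
    refine Set.image_mono fun z hz => ?_
    obtain ⟨t, h0, h1, h2, h3⟩ := mem_segment_prod hz
    simp only at h2 h3
    exact ⟨by linarith, by linarith, by linarith⟩
  | succ r hr ih =>
    obtain ⟨Z⟩ := nonempty_gadget_bentLens hrk
      (fun R hR f hf α => ih (by omega) R hR f hf α) R hR f hf α
    exact ⟨{ Z with drawn := Z.drawn.mono (Set.image_mono fun z hz => hz.1) }⟩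

/-! ### The extremal planar graph -/

/-- There are `2 * k + 1` neighbours of `p` any two of which are joined by a short odd walk. -/
def SimpleGraph.HasOddStar {V : Type*} (G : SimpleGraph V) (k : ℕ) (p : V) : Prop :=
  ∃ v : Fin (2 * k + 1) → V, (∀ i, G.Adj p (v i)) ∧
    ∀ i j, i ≠ j → ∃ l, Odd l ∧ l < 2 * k ∧ G.HasWalk (v i) (v j) l

theorem exists_planar_clique {k : ℕ} (hk : 1 ≤ k) (f : ℝ × ℝ →ᵃ[ℝ] ℝ × ℝ)
    (hf : Function.Injective f) :
    ∃ V G φ arc, IsDrawnIn (projectiveCube (2 * k)) (f '' planeWedge) V G φ arc ∧ f (0, 0) ∈ V ∧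
      G.HasOddStar k (f (0, 0)) ∧
      ∃ v : Fin (2 ^ (2 * k)) → ℝ × ℝ, (∀ i, v i ∈ V) ∧
        ∀ i j, i ≠ j → ∃ l, Odd l ∧ l < 2 * k ∧ G.HasWalk (v i) (v j) l := by
  classical
  obtain ⟨r, hr⟩ : ∃ r, 2 * k = r + 1 := ⟨2 * k - 1, by omega⟩
  -- All generators but `J`: the labels of the poles then differ by `J`, so the closing edge
  -- respects the labelling.
  let R : Finset (Option (Fin (2 * k))) := Finset.univ.erase none
  have hR : R.card = r + 1 := by simp [R, hr]
  obtain ⟨Z⟩ := nonempty_gadget_bentLens (k := k) (r := r) (by omega)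
    (fun R hR f hf α => nonempty_gadget_lens (by omega) (by omega) R hR f hf α) R hR f hf 0
  have hst : f (0, 0) ≠ f (1, 0) := fun e => by simpa using hf e
  have hQ := projectiveCube_hasWalk_compl (d := 2 * k) (by omega) 0 R
  rw [hR, ← hr, Nat.add_sub_cancel_left] at hQ
  obtain ⟨w, hw⟩ := hQ
  obtain ⟨φ', h1, h2, hd⟩ := exists_isDrawnIn_edge (w.adj_of_length_eq_one hw) hst
  obtain ⟨φ, arc, -, -, h⟩ := Z.drawn.union hd (fun p hp hp' => by
    rw [← image_segment] at hp'
    obtain ⟨z, hz, hz', rfl⟩ := mem_image_of_injective_inter hf hp hp'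
    obtain ⟨t, h3, h4, h5, h6⟩ := mem_segment_prod hz'
    simp only at h5 h6
    have hz2 : z.2 = 0 := by linarith
    have hz1 : z = (0, 0) ∨ z = (1, 0) := by
      obtain ⟨⟨h7, h8, h9⟩, h10 | h10⟩ := hz
      · exact .inl (Prod.ext (le_antisymm (by linarith) (by linarith)) hz2)
      · exact .inr (Prod.ext (le_antisymm (by linarith) (by linarith)) hz2)
    rcases hz1 with rfl | rfl
    · exact ⟨Z.s_mem, by simp, by rw [Z.φ_s, h1]⟩
    · exact ⟨Z.t_mem, by simp, by rw [Z.φ_t, h2]⟩)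
  have hadj := edge_adj_of_ne hst
  have hcl := Z.clique (Z.G ⊔ SimpleGraph.edge (f (0, 0)) (f (1, 0))) le_sup_left
    ((hadj.hasWalk.mono le_sup_right).cast (by omega))
  let _ := Z.fintype
  refine ⟨_, _, φ, arc, h.mono ?_, .inl Z.s_mem, ?_, ?_⟩
  · refine Set.union_subset (Set.image_mono ?_) ?_
    · rintro z ⟨⟨h7, h8, h9⟩, -⟩
      exact ⟨h7, h8, by linarith⟩
    · rw [← image_segment]
      refine Set.image_mono fun z hz => ?_
      obtain ⟨t, h3, h4, h5, h6⟩ := mem_segment_prod hz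
      simp only at h5 h6
      exact ⟨by linarith, by linarith, by linarith⟩
  -- To the `2 * k` neighbours of `s` in the gadget the closing edge adds `t`.
  · have hcard : (insert Z.it Z.N).card = 2 * k + 1 := by
      rw [Finset.card_insert_of_notMem (Z.it_notMem (by omega)), Z.card_N, hr]
    let e := (insert Z.it Z.N).equivFinOfCardEq hcard
    refine ⟨fun i => Z.v (e.symm i), fun i => ?_, fun i j hij => hcl _ _ fun he => hij ?_⟩
    · rcases Finset.mem_insert.1 (e.symm i).2 with hi | hi
      · simp only [hi, Z.v_it]
        exact .inr hadj
      · exact .inl (Z.adj _ hi)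
    · exact e.symm.injective (Subtype.ext he)
  · let e := Fintype.equivFinOfCardEq (n := 2 ^ (2 * k)) (Z.card_ι.trans (by rw [hr]))
    exact ⟨fun i => Z.v (e.symm i), fun i => .inl (Z.v_mem _),
      fun i j hij => hcl _ _ fun he => hij (e.symm.injective he)⟩

/-! ### Attaching gadgets to a planar graph -/

open SimpleGraph

theorem IsDrawnIn.forget {T : Type*} {Q : SimpleGraph T} {K V : Set (ℝ × ℝ)}
    {G : SimpleGraph (ℝ × ℝ)} {φ : ℝ × ℝ → T} {arc : Sym2 (ℝ × ℝ) → Set (ℝ × ℝ)}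
    (h : IsDrawnIn Q K V G φ arc) : IsDrawnIn ⊤ K V G id arc :=
  { h with hom := fun _ _ huv => huv.ne }

namespace SimpleGraph

variable {V V' : Type*} {G H : SimpleGraph V} {G' : SimpleGraph V'} {k : ℕ} {p : V}

/-- Gluing two graphs at a vertex does not create new odd cycles. -/
theorem le_oddGirth_sup {A B : Set V} (hG : ∀ x y, G.Adj x y → x ∈ A)
    (hH : ∀ x y, H.Adj x y → x ∈ B) (hAB : A ∩ B ⊆ {p}) {n : ℕ} (hnG : (n : ℕ∞) ≤ G.oddGirth)
    (hnH : (n : ℕ∞) ≤ H.oddGirth) : (n : ℕ∞) ≤ (G ⊔ H).oddGirth := by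
  classical
  -- Collapsing everything outside one part to `p` splits a walk into a walk in each part; for an
  -- odd closed walk, one of the two is odd.
  have key : ∀ {u v : V} (w : (G ⊔ H).Walk u v), ∃ l m, l + m = w.length ∧
      G.HasWalk (if u ∈ A then u else p) (if v ∈ A then v else p) l ∧
      H.HasWalk (if u ∈ B then u else p) (if v ∈ B then v else p) m := by
    intro u v w
    induction w with
    | nil => exact ⟨0, 0, rfl, .refl _, .refl _⟩
    | @cons u x v hadj w ih =>
      obtain ⟨l, m, hlm, h1, h2⟩ := ih
      rw [Walk.length_cons]
      have off : ∀ {C D : Set V}, C ∩ D ⊆ {p} → ∀ y ∈ C, (if y ∈ D then y else p) = p := by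
        intro C D hCD y hy
        split_ifs with hD
        · exact hCD ⟨hy, hD⟩
        · rfl
      rcases hadj with hadj | hadj
      · have hu := hG _ _ hadj
        have hx := hG _ _ hadj.symm
        refine ⟨1 + l, m, by omega, ?_, ?_⟩
        · rw [if_pos hx] at h1
          rw [if_pos hu]
          exact hadj.hasWalk.trans h1
        · rw [off hAB x hx] at h2
          rwa [off hAB u hu]
      · have hu := hH _ _ hadj
        have hx := hH _ _ hadj.symm
        rw [Set.inter_comm] at hAB
        refine ⟨l, 1 + m, by omega, ?_, ?_⟩
        · rw [off hAB x hx] at h1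
          rwa [off hAB u hu]
        · rw [if_pos hx] at h2
          rw [if_pos hu]
          exact hadj.hasWalk.trans h2
  rw [le_oddGirth_iff] at *
  rintro a _ ⟨w, rfl⟩ hl
  obtain ⟨l, m, hlm, h1, h2⟩ := key w
  rw [← hlm] at hl ⊢
  rcases Nat.even_or_odd l with hl' | hl'
  · have := hnH _ m h2 ((Nat.odd_add'.1 hl).2 hl')
    omega
  · have := hnG _ l h1 hl'
    omega

theorem HasOddStar.mono (h : G.HasOddStar k p) (hGH : G ≤ H) : H.HasOddStar k p := by
  obtain ⟨v, h1, h2⟩ := h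
  refine ⟨v, fun i => hGH (h1 i), fun i j hij => ?_⟩
  obtain ⟨l, h3, h4, h5⟩ := h2 i j hij
  exact ⟨l, h3, h4, h5.mono hGH⟩

theorem HasOddStar.induce {S : Set V} (h : G.HasOddStar k p) (hS : ∀ x y, G.Adj x y → x ∈ S)
    (hp : p ∈ S) : (G.induce S).HasOddStar k ⟨p, hp⟩ := by
  obtain ⟨v, h1, h2⟩ := h
  refine ⟨fun i => ⟨v i, hS _ _ (h1 i).symm⟩, h1, fun i j hij => ?_⟩
  obtain ⟨l, h3, h4, h5⟩ := h2 i j hij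
  exact ⟨l, h3, h4, h5.induce hS _ _⟩

theorem HasOddStar.oddGirth_le (h : G.HasOddStar k p) (hk : 1 ≤ k) :
    G.oddGirth ≤ (2 * k + 1 : ℕ) := by
  obtain ⟨v, h1, h2⟩ := h
  obtain ⟨l, h3, h4, h5⟩ := h2 ⟨0, by omega⟩ ⟨1, by omega⟩ (by simp)
  refine (oddGirth_le_of_hasWalk (((h1 _).hasWalk.trans h5).trans (h1 _).symm.hasWalk) ?_).trans
    (Nat.cast_le.2 ?_)
  · rw [Nat.odd_iff] at *
    omega
  · rw [Nat.odd_iff] at h3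
    omega

/-- Vertices joined by a short odd walk have different images. -/
theorem Hom.map_ne_of_hasWalk (f : G →g G') (hG' : ((2 * k + 1 : ℕ) : ℕ∞) ≤ G'.oddGirth) {u v : V}
    (h : ∃ l, Odd l ∧ l < 2 * k ∧ G.HasWalk u v l) : f u ≠ f v := by
  obtain ⟨l, h1, h2, h3⟩ := h
  intro e
  have h4 := h3.map f
  rw [e] at h4
  have := le_oddGirth_iff.1 hG' _ l h4 h1
  omega

theorem HasOddStar.le_degree (h : G.HasOddStar k p) (f : G →g G')
    (hG' : ((2 * k + 1 : ℕ) : ℕ∞) ≤ G'.oddGirth) [Fintype (G'.neighborSet (f p))] :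
    2 * k + 1 ≤ G'.degree (f p) := by
  obtain ⟨v, h1, h2⟩ := h
  have hinj : Function.Injective fun i => (⟨f (v i), f.map_adj (h1 i)⟩ : G'.neighborSet (f p)) := by
    intro i j hij
    by_contra hne
    exact f.map_ne_of_hasWalk hG' (h2 i j hne) (congrArg Subtype.val hij)
  rw [← card_neighborSet_eq_degree]
  simpa using Fintype.card_le_of_injective _ hinj

end SimpleGraph

/-- An extremal planar graph of odd-girth `2 * k + 1`. -/
theorem exists_planar_oddGirth_eq {k : ℕ} (hk : 1 ≤ k) :
    ∃ (W : Type) (_ : Finite W) (G : SimpleGraph W), G.IsPlanar ∧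
      G.oddGirth = ((2 * k + 1 : ℕ) : ℕ∞) ∧ Nonempty (G →g projectiveCube (2 * k)) ∧
      ∃ v : Fin (2 ^ (2 * k)) → W,
        ∀ i j, i ≠ j → ∃ l, Odd l ∧ l < 2 * k ∧ G.HasWalk (v i) (v j) l := by
  obtain ⟨V, G, φ, arc, hd, hmem, hstar, v, hv, hcl⟩ :=
    exists_planar_clique hk (AffineMap.id ℝ (ℝ × ℝ)) Function.injective_id
  have hS := hd.adj_mem
  have f : G.induce V →g projectiveCube (2 * k) :=
    ⟨fun x => φ x, fun {x y} hxy => hd.hom x y hxy⟩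
  refine ⟨V, hd.finite.to_subtype, G.induce V, hd.isPlanar_induce, le_antisymm ?_ ?_, ⟨f⟩,
    fun i => ⟨v i, hv i⟩, fun i j hij => ?_⟩
  · exact (hstar.induce hS hmem).oddGirth_le hk
  · exact (le_oddGirth_projectiveCube hk).trans f.oddGirth_le
  · obtain ⟨l, h1, h2, h3⟩ := hcl i j hij
    exact ⟨l, h1, h2, h3.induce hS _ _⟩

/-- A copy of the gadget can be attached at any vertex of a plane graph. -/
theorem IsDrawnIn.exists_attach {k : ℕ} (hk : 1 ≤ k) {K V : Set (ℝ × ℝ)}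
    {G : SimpleGraph (ℝ × ℝ)} {arc : Sym2 (ℝ × ℝ) → Set (ℝ × ℝ)} (h : IsDrawnIn ⊤ K V G id arc)
    (hG : ((2 * k + 1 : ℕ) : ℕ∞) ≤ G.oddGirth) {p : ℝ × ℝ} (hp : p ∈ V) :
    ∃ K' V' G' arc', IsDrawnIn ⊤ K' V' G' id arc' ∧ V ⊆ V' ∧ G ≤ G' ∧
      ((2 * k + 1 : ℕ) : ℕ∞) ≤ G'.oddGirth ∧ G'.HasOddStar k p := by
  obtain ⟨F, hF, hd⟩ := h.exists_segments
  obtain ⟨f, hf, rfl, hfp⟩ := exists_wedge_at F hF p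
  obtain ⟨V', G', φ, arc', hd', hmem, hstar, -⟩ := exists_planar_clique hk f hf
  obtain ⟨_, arc₁, -, -, hd₁⟩ := hd.union hd'.forget (fun q hq hq' => by
    rw [hfp ⟨hq, hq'⟩]
    exact ⟨hp, hmem, rfl⟩)
  refine ⟨_, _, _, arc₁, hd₁.forget, Set.subset_union_left, le_sup_left, ?_,
    hstar.mono le_sup_right⟩
  refine le_oddGirth_sup hd.adj_mem hd'.adj_mem
    ((Set.inter_subset_inter hd.subset hd'.subset).trans hfp) hG ?_
  exact (le_oddGirth_projectiveCube hk).trans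
    (Hom.oddGirth_le ⟨φ, fun {x y} hxy => hd'.hom x y hxy⟩)

theorem IsDrawnIn.exists_attach_all {k : ℕ} (hk : 1 ≤ k) {K V : Set (ℝ × ℝ)}
    {G : SimpleGraph (ℝ × ℝ)} {arc : Sym2 (ℝ × ℝ) → Set (ℝ × ℝ)} (h : IsDrawnIn ⊤ K V G id arc)
    (hG : ((2 * k + 1 : ℕ) : ℕ∞) ≤ G.oddGirth) {S : Set (ℝ × ℝ)} (hS : S.Finite) (hSV : S ⊆ V) :
    ∃ K' V' G' arc', IsDrawnIn ⊤ K' V' G' id arc' ∧ V ⊆ V' ∧ G ≤ G' ∧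
      ((2 * k + 1 : ℕ) : ℕ∞) ≤ G'.oddGirth ∧ ∀ p ∈ S, G'.HasOddStar k p := by
  induction S, hS using Set.Finite.induction_on with
  | empty => exact ⟨K, V, G, arc, h, subset_rfl, le_rfl, hG, by simp⟩
  | @insert p S _ _ ih =>
    obtain ⟨K₁, V₁, G₁, arc₁, h1, h2, h3, h4, h5⟩ := ih ((Set.subset_insert _ _).trans hSV)
    obtain ⟨K₂, V₂, G₂, arc₂, h6, h7, h8, h9, h10⟩ :=
      h1.exists_attach hk h4 (h2 (hSV (Set.mem_insert p S)))
    refine ⟨K₂, V₂, G₂, arc₂, h6, h2.trans h7, h3.trans h8, h9, ?_⟩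
    rintro q (rfl | hq)
    · exact h10
    · exact (h5 q hq).mono h8

/-- Every planar graph of odd-girth `2 * k + 1` extends to one in which all the old vertices have
`2 * k + 1` neighbours that no homomorphism to a graph of odd-girth `2 * k + 1` identifies. -/
theorem SimpleGraph.IsPlanar.exists_hasOddStar {k : ℕ} (hk : 1 ≤ k) {W : Type} [Finite W]
    {G : SimpleGraph W} (hG : G.IsPlanar) (hgirth : G.oddGirth = ((2 * k + 1 : ℕ) : ℕ∞)) :
    ∃ (W' : Type) (_ : Finite W') (G' : SimpleGraph W'), G'.IsPlanar ∧
      G'.oddGirth = ((2 * k + 1 : ℕ) : ℕ∞) ∧ ∃ f : G →g G', ∀ w, G'.HasOddStar k (f w) := by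
  obtain ⟨D⟩ := hG
  -- An empty graph has odd-girth `⊤`; a vertex is needed for `Function.invFun`.
  have hW : Nonempty W := by
    by_contra hW
    rw [not_nonempty_iff] at hW
    rw [oddGirth, iInf_of_empty] at hgirth
    exact ENat.natCast_ne_top _ hgirth.symm
  obtain ⟨K, arc, hd⟩ := D.isDrawnIn
  have hret : G.map D.point →g G :=
    ⟨Function.invFun D.point, by
      rintro _ _ ⟨-, a, b, hab, rfl, rfl⟩
      rwa [Function.leftInverse_invFun D.point_injective,
        Function.leftInverse_invFun D.point_injective]⟩
  obtain ⟨K', V', G', arc', h1, h2, h3, h4, h5⟩ := hd.exists_attach_all hk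
    (hgirth.symm.le.trans hret.oddGirth_le) (Set.finite_range D.point) subset_rfl
  have hmem : ∀ w, D.point w ∈ V' := fun w => h2 ⟨w, rfl⟩
  have f : {f : G →g G'.induce V' // ∀ w, f w = ⟨D.point w, hmem w⟩} :=
    ⟨⟨fun w => ⟨D.point w, hmem w⟩, fun {a b} hab =>
      h3 ⟨fun e => hab.ne (D.point_injective e), a, b, hab, rfl, rfl⟩⟩, fun _ => rfl⟩
  refine ⟨V', h1.finite.to_subtype, G'.induce V', h1.isPlanar_induce, le_antisymm ?_ ?_,
    f.1, fun w => ?_⟩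
  · exact f.1.oddGirth_le.trans hgirth.le
  · exact h4.trans (Embedding.induce V').toHom.oddGirth_le
  · rw [f.2]
    exact (h5 _ ⟨w, rfl⟩).induce h1.adj_mem _

/-! ### Order, degrees and size of bounds -/

namespace IsPlanarBound

variable {k : ℕ} {V : Type*} {B : SimpleGraph V}

theorem two_pow_le_card [Fintype V] (hk : 1 ≤ k) (hB : IsPlanarBound k B) :
    2 ^ (2 * k) ≤ Fintype.card V := by
  obtain ⟨W, _, G, h1, h2, -, v, h3⟩ := exists_planar_oddGirth_eq hk
  obtain ⟨f⟩ := hB.2 W G h1 h2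
  have hinj : Function.Injective fun i => f (v i) := by
    intro i j hij
    by_contra hne
    exact f.map_ne_of_hasWalk hB.1.symm.le (h3 i j hne) hij
  simpa using Fintype.card_le_of_injective _ hinj

theorem le_degree (hk : 1 ≤ k) (hB : IsPlanarBound k B) (v : V)
    [Fintype (B.neighborSet v)] (hv : ¬ IsPlanarBound k (B.induce {v}ᶜ)) :
    2 * k + 1 ≤ B.degree v := by
  obtain ⟨W, _, G, h1, h2, h3⟩ : ∃ (W : Type) (_ : Finite W) (G : SimpleGraph W), G.IsPlanar ∧
      G.oddGirth = ((2 * k + 1 : ℕ) : ℕ∞) ∧ IsEmpty (G →g B.induce {v}ᶜ) := by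
    -- Otherwise `B - v` would be a bound: its odd-girth cannot drop below that of `B`, and cannot
    -- exceed `2 * k + 1` because the extremal planar graph maps to it.
    by_contra! hcon
    refine hv ⟨le_antisymm ?_ ?_, fun W _ G h1 h2 => hcon W inferInstance G h1 h2⟩
    · obtain ⟨W, hW, G, h1, h2, -⟩ := exists_planar_oddGirth_eq hk
      obtain ⟨f⟩ := hcon W hW G h1 h2
      exact f.oddGirth_le.trans h2.le
    · exact hB.1.symm.le.trans (Embedding.induce _).toHom.oddGirth_le
  obtain ⟨W', _, G', h4, h5, f, h6⟩ := h1.exists_hasOddStar hk h2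
  obtain ⟨g⟩ := hB.2 W' G' h4 h5
  -- If `v` were missed, `g ∘ f` would map `G` to `B - v`.
  obtain ⟨w, rfl⟩ : ∃ w, g (f w) = v := by
    by_contra! hne
    exact h3.false ⟨fun w => ⟨g (f w), hne w⟩, fun {a b} hab => g.map_adj (f.map_adj hab)⟩
  exact (h6 w).le_degree g hB.1.symm.le

theorem exists_minimal [Finite V] (hB : IsPlanarBound k B) :
    ∃ S : Set V, IsPlanarBound k (B.induce S) ∧
      ∀ v : S, ¬ IsPlanarBound k ((B.induce S).induce {v}ᶜ) := by
  obtain ⟨S, hS⟩ := (Set.toFinite {S : Set V | IsPlanarBound k (B.induce S)}).exists_minimal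
    ⟨Set.univ, hB.of_hom ⟨fun x => ⟨x, trivial⟩, fun {_ _} h => h⟩ (Embedding.induce _).toHom⟩
  refine ⟨S, hS.1, fun v hv => ?_⟩
  have h : IsPlanarBound k (B.induce (S \ {v.1})) := hv.of_hom
    ⟨fun x => ⟨x.1.1, x.1.2, fun e => x.2 (Subtype.ext e)⟩, fun {_ _} h => h⟩
    ⟨fun x => ⟨⟨x.1, x.2.1⟩, fun e => x.2.2 (congrArg Subtype.val e)⟩, fun {_ _} h => h⟩
  exact (hS.2 h Set.sdiff_subset v.2).2 rfl

/-- The degree bound needs vertex-minimality, so the edges are counted in a minimal induced bound,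
which still has at least `2 ^ (2 * k)` vertices. -/
theorem le_two_mul_ncard_edgeSet [Finite V] (hk : 1 ≤ k) (hB : IsPlanarBound k B) :
    2 ^ (2 * k) * (2 * k + 1) ≤ 2 * B.edgeSet.ncard := by
  classical
  cases nonempty_fintype V
  obtain ⟨S, hS, hmin⟩ := hB.exists_minimal
  have h1 : (B.induce S).edgeSet.ncard ≤ B.edgeSet.ncard := by
    refine Set.ncard_le_ncard_of_injOn (Sym2.map Subtype.val) (fun e => ?_)
      (Sym2.map.injective Subtype.val_injective).injOn (Set.toFinite _)
    induction e with
    | _ x y => exact fun h => h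
  have h2 : 2 ^ (2 * k) * (2 * k + 1) ≤ 2 * (B.induce S).edgeSet.ncard := by
    rw [← coe_edgeFinset, Set.ncard_coe_finset, ← sum_degrees_eq_twice_card_edges]
    calc 2 ^ (2 * k) * (2 * k + 1) ≤ Fintype.card S * (2 * k + 1) :=
          Nat.mul_le_mul_right _ (hS.two_pow_le_card hk)
      _ = ∑ _v : S, (2 * k + 1) := by simp
      _ ≤ _ := Finset.sum_le_sum fun v _ => hS.le_degree hk v (hmin v)
  omega

end IsPlanarBound

theorem PlanarProjectiveCubeConjecture.isPlanarBound {k : ℕ} (hk : 1 ≤ k)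
    (h : PlanarProjectiveCubeConjecture k) : IsPlanarBound k (projectiveCube (2 * k)) := by
  refine ⟨le_antisymm ?_ (le_oddGirth_projectiveCube hk), fun W _ G h1 h2 => h W G h1 h2.symm.le⟩
  obtain ⟨W, _, G, -, h2, ⟨f⟩, -⟩ := exists_planar_oddGirth_eq hk
  exact f.oddGirth_le.trans h2.le

theorem mainTheorem2 (k : ℕ) (hk : 1 ≤ k) :
    (∀ (V : Type u) [Fintype V] (B : SimpleGraph V) [DecidableRel B.Adj],
      (IsPlanarBound k B → 2 ^ (2 * k) ≤ Fintype.card V) ∧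
      (IsMinimalPlanarBound k B → 2 * k + 1 ≤ B.minDegree)) ∧
    (PlanarProjectiveCubeConjecture k →
      IsPlanarBound k (projectiveCube (2 * k)) ∧
      ∀ (V : Type u) [Finite V] (B : SimpleGraph V), IsPlanarBound k B →
        Nat.card (Fin (2 * k) → ZMod 2) ≤ Nat.card V ∧
        (projectiveCube (2 * k)).edgeSet.ncard ≤ B.edgeSet.ncard) := by
  refine ⟨fun V _ B _ => ⟨fun hB => hB.two_pow_le_card hk, fun hB => ?_⟩,
    fun hconj => ⟨hconj.isPlanarBound hk, fun V _ B hB => ⟨?_, ?_⟩⟩⟩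
  · have hV : Nonempty V :=
      Fintype.card_pos_iff.1 (lt_of_lt_of_le (by positivity) (hB.1.two_pow_le_card hk))
    refine B.le_minDegree_of_forall_le_degree _ fun v => hB.1.le_degree hk v (hB.2 _ ?_)
    exact fun h => (h ▸ Set.mem_univ v : v ∈ ({v}ᶜ : Set V)) rfl
  · cases nonempty_fintype V
    rw [Nat.card_eq_fintype_card, Nat.card_eq_fintype_card]
    simpa [ZMod.card] using hB.two_pow_le_card hk
  · have h1 := two_mul_ncard_edgeSet_projectiveCube_le (d := 2 * k) (by omega)
    have h2 := hB.le_two_mul_ncard_edgeSet hk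
    omega
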